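/- Let $n\ge 1$. Write $I_m=\{1,\dots,m\}$ for the index set of type $A_m$, $\alpha_i$ for the simple roots, $s_i$ for the simple reflections, and let $i^*=i^\vee=2n+2-i$ on $I_{2n+1}$ (for a word, $(j_1\cdots j_l)^\vee=j_1^\vee\cdots j_l^\vee$). Let $[\![Q^\diamondsuit]\!]$ be the twisted adapted cluster point of type $A_{2n+1}$, i.e. the set of all commutation classes of reduced words of the longest element that are obtained from the class of $\prod_{k=0}^{2n}(1\,2\cdots n{+}1)^{k\vee}$ by reflection functors ($i\,u\mapsto u\,i^*$ and $u\,i\mapsto i^*u$). Fix a reduced word $\boldsymbol i_0=i_1i_2\cdots i_N$ with $[\boldsymbol i_0]\in[\![Q^\diamondsuit]\!]$, and let $\beta_k=s_{i_1}\cdots s_{i_{k-1}}(\alpha_{i_k})$. The quiver $\Upsilon=\Upsilon_{[\boldsymbol i_0]}$ has the positive roots $\beta_1,\dots,\beta_N$ of type $A_{2n+1}$ as vertices, $\beta_k$ having residue $i_k$; there is an arrow $\beta_k\to\beta_j$ if $|i_k-i_j|=1$, $j$ is the last index before $k$ with letter $i_j$, and $k$ is the first index after $j$ with letter $i_k$.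 Let $P$ be the monoid homomorphism on words with $P(i)=i$ for $i\le n$, $P(n+1)=$ the empty word, $P(j)=j-1$ for $j\ge n+2$. Let $Q$ be the Dynkin quiver of type $A_{2n}$ to which $P(\boldsymbol i_0)$ is adapted, $\phi_Q$ its Coxeter element, and $\xi$ a height function of $Q$ ($\xi(j)=\xi(i)+1$ for every arrow $i\to j$). The coordinates in $\Gamma_Q$ are given by $\Omega_Q(\beta^{\phi_Q}_k)=(j_k,\xi(j_k))$ for a reduced word $j_1\cdots j_{2n}$ of $\phi_Q$ adapted to $Q$, where $\beta^{\phi_Q}_k=s_{j_1}\cdots s_{j_{k-1}}(\alpha_{j_k})$, and $\Omega_Q(\phi_Q(\gamma))=(i,p-2)$ if $\Omega_Q(\gamma)=(i,p)$ and $\phi_Q(\gamma)$ is a positive root. The coordinates $\Omega=\Omega_{[\boldsymbol i_0]}$ of the vertices of $\Upsilon$, with values in $I_{2n+1}\times\frac12\mathbb Z$, are as follows. A vertex $\beta_k$ with $i_k\neq n+1$ corresponds to the letter $P(i_k)$ of $P(\boldsymbol i_0)$, hence to a vertex of $\Gamma_Q$ (the root labelling that letter); if the latter has coordinate $(i,p)$,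 then $\Omega(\beta_k)=(i^+,p)$ with $i^+=i$ for $i\le n$ and $i^+=i+1$ for $i>n$. A vertex $v$ of residue $n+1$ has coordinate $(n+1,p+\frac12)$ if it is a sink of $\Upsilon$ joined to a vertex of coordinate $(j,p)$; $(n+1,p-\frac12)$ if it is a source of $\Upsilon$ joined to a vertex of coordinate $(j,p)$; and $(n+1,p+\frac12)$ if there are arrows $(j,p)\to v\to(j',p+1)$ with $\{j,j'\}=\{n,n+2\}$. (a) Let $\alpha,\beta$ be positive roots with $\Omega(\beta)=(i,p)$ and $\Omega(\alpha)=(i,\,p-2+\delta_{i,n+1})$. Then $$\beta+\alpha=\sum_{\Omega(\gamma)=(j,q)}\gamma,\qquad q=p-\frac1{1+\delta_{i,n+1}},$$ where the sum runs over all positive roots $\gamma$ whose coordinate is $(j,q)$ with $j\in\{n,n+3\}$ if $i=n+2$, $j\in\{n-1,n+2\}$ if $i=n$, and $j\in\{i-1,i+1\}$ otherwise (only $j\in I_{2n+1}$ can occur). (b) Equivalently, let $\bar i\in\{1,\dots,n+1\}$ be the smallest element of the orbit $\{i,i^\vee\}$, let $|\bar i|$ be the number of elements of that orbit, and let a positive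 root with $\Omega$-coordinate $(i,\frac s2)$ have folded coordinate $(\bar i,s)\in\{1,\dots,n+1\}\times\mathbb Z$. If $\beta$ and $\alpha$ have folded coordinates $(\bar i,s)$ and $(\bar i,s-2^{|\bar i|})$, then $\alpha+\beta$ is the sum of all positive roots $\gamma$ that lie on a path from $\alpha$ to $\beta$ in $\Upsilon$ and have folded coordinate $(j,s-2^{|\bar i|-1})$ for some $j$. -/

import Mathlib

/-! ### Type `A_m`: Weyl group, roots, words

The index set of `A_m` is `I_m = {1, …, m}`, its Weyl group is the symmetric group on
`{1, …, m+1}` (inside the permutations of `ℕ`), acting on the lattice with basis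
`e_1, e_2, …` by permuting coordinates; the simple roots are `α_i = e_i - e_{i+1}`. -/

namespace TwistedAR

/-- The lattice containing the root lattices of all types `A_m`. -/
abbrev Lattice := ℕ → ℤ

/-- `α_i = e_i - e_{i+1}`. -/
def simpleRoot (i : ℕ) : Lattice := Pi.single i 1 - Pi.single (i + 1) 1

/-- The positive roots of type `A_m`: the sums `[a,b] = α_a + ⋯ + α_b` with `1 ≤ a ≤ b ≤ m`. -/
noncomputable def posRoots (m : ℕ) : Finset Lattice := by
  classical
  exact ((Finset.Icc 1 m ×ˢ Finset.Icc 1 m).filter (fun x => x.1 ≤ x.2)).image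
    (fun x => ∑ k ∈ Finset.Icc x.1 x.2, simpleRoot k)

/-- The element `s_{i_1} ⋯ s_{i_l}` of the Weyl group given by the word `i_1 ⋯ i_l`,
where `s_i` exchanges `i` and `i + 1`. -/
def weyl (w : List ℕ) : Equiv.Perm ℕ := (w.map (fun i => Equiv.swap i (i + 1))).prod

/-- The linear action `σ e_a = e_{σ a}`. -/
def act (σ : Equiv.Perm ℕ) (v : Lattice) : Lattice := fun x => v (σ⁻¹ x)

/-- `γ = β_k = s_{i_1} ⋯ s_{i_{k-1}} (α_{i_k})` is the label of the `k`-th letter, which is `i`,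
of the word `w = i_1 i_2 ⋯` (positions are counted from `0` in the code). -/
def IsLabel (w : List ℕ) (k i : ℕ) (γ : Lattice) : Prop :=
  w[k]? = some i ∧ γ = act (weyl (w.take k)) (simpleRoot i)

/-! ### Commutation classes, reflection functors, the twisted adapted cluster point -/

/-- The automorphism `i ↦ i^∨ = 2n+2-i` of the diagram `A_{2n+1}`; it is also the involution
`i ↦ i^*` induced by the longest element. -/
def vee (n i : ℕ) : ℕ := 2 * n + 2 - i

/-- `w'` arises from `w` by one commutation relation `i j = j i`, `i` and `j` not adjacent. -/
def CommStep (w w' : List ℕ) : Prop :=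
  ∃ (u v : List ℕ) (i j : ℕ), (i + 1 < j ∨ j + 1 < i) ∧
    w = u ++ [i, j] ++ v ∧ w' = u ++ [j, i] ++ v

/-- `w'` arises from `w` by a reflection functor: `i u ↦ u i^*` (right action of `r_i`, `i` a
sink) or `u i ↦ i^* u` (left action of `r_i`, `i` a source). -/
def ReflStep (n : ℕ) (w w' : List ℕ) : Prop :=
  ∃ (u : List ℕ) (i : ℕ),
    (w = [i] ++ u ∧ w' = u ++ [vee n i]) ∨ (w = u ++ [i] ∧ w' = [vee n i] ++ u)

/-- The word `∏_{k=0}^{2n} (1 2 ⋯ n+1)^{k∨}`, a reduced word of the longest element. -/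
def baseWord (n : ℕ) : List ℕ :=
  (List.range (2 * n + 1)).flatMap (fun k => (List.range' 1 (n + 1)).map ((vee n)^[k]))

/-- `w` is a (necessarily reduced) word of the longest element whose commutation class lies in
the twisted adapted cluster point of type `A_{2n+1}`. -/
def IsTwistedAdapted (n : ℕ) (w : List ℕ) : Prop :=
  Relation.ReflTransGen (fun u v => CommStep u v ∨ ReflStep n u v) (baseWord n) w

/-! ### The combinatorial Auslander–Reiten quiver of a word -/

/-- There is an arrow from the vertex at position `k` to the vertex at position `j`: the letters
`i_k`, `i_j` are adjacent, `j` is the last position before `k` with letter `i_j`, and `k` is the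
first position after `j` with letter `i_k`. -/
def PosArrow (w : List ℕ) (k j : ℕ) : Prop :=
  ∃ a b : ℕ, w[k]? = some a ∧ w[j]? = some b ∧ (a = b + 1 ∨ b = a + 1) ∧
    IsGreatest {j' | j' < k ∧ w[j']? = some b} j ∧
    IsLeast {k' | j < k' ∧ w[k']? = some a} k

/-- The arrows of the combinatorial AR-quiver, between positive roots. -/
def RootArrow (w : List ℕ) (β γ : Lattice) : Prop :=
  ∃ k j a b : ℕ, IsLabel w k a β ∧ IsLabel w j b γ ∧ PosArrow w k j

/-! ### Dynkin quivers of type `A_m` and their AR-quivers -/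

/-- A Dynkin quiver of type `A_m`: an orientation of the edges of the diagram `1 - 2 - ⋯ - m`. -/
structure DynkinQuiver (m : ℕ) where
  Arrow : ℕ → ℕ → Prop
  adj : ∀ i j, Arrow i j → (1 ≤ i ∧ i ≤ m) ∧ (1 ≤ j ∧ j ≤ m) ∧ (j = i + 1 ∨ i = j + 1)
  oriented : ∀ i, 1 ≤ i → i + 1 ≤ m → Xor (Arrow i (i + 1)) (Arrow (i + 1) i)

namespace DynkinQuiver

variable {m : ℕ}

/-- `i Q`: the quiver `Q` with all arrows incident with `i` reversed. -/
def reflect (Q : DynkinQuiver m) (i : ℕ) : DynkinQuiver m where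
  Arrow a b := ((a = i ∨ b = i) ∧ Q.Arrow b a) ∨ (¬ (a = i ∨ b = i) ∧ Q.Arrow a b)
  adj a b h := by
    rcases h with ⟨_, h⟩ | ⟨_, h⟩
    · obtain ⟨h1, h2, h3⟩ := Q.adj _ _ h
      exact ⟨h2, h1, h3.symm⟩
    · exact Q.adj _ _ h
  oriented a h1 h2 := by
    have h := Q.oriented a h1 h2
    by_cases hc : a = i ∨ a + 1 = i
    · have hc' : a + 1 = i ∨ a = i := hc.symm
      simp only [hc, hc', true_and, not_true_eq_false, false_and, or_false]
      exact (xor_comm _ _).mp h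
    · have hc' : ¬ (a + 1 = i ∨ a = i) := fun h => hc h.symm
      simpa only [hc, hc', false_and, not_false_eq_true, true_and, false_or] using h

/-- `i` is a sink of `Q`. -/
def IsSink (Q : DynkinQuiver m) (i : ℕ) : Prop :=
  1 ≤ i ∧ i ≤ m ∧ ∀ j, ¬ Q.Arrow i j

/-- The word `i_1 i_2 ⋯ i_l` is adapted to `Q`: `i_k` is a sink of `i_{k-1} ⋯ i_1 Q` for all `k`. -/
def Adapted : DynkinQuiver m → List ℕ → Prop
  | _, [] => True
  | Q, i :: w => Q.IsSink i ∧ Adapted (Q.reflect i) w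

/-- `ξ` is a height function of `Q`. -/
def IsHeight (Q : DynkinQuiver m) (ξ : ℕ → ℤ) : Prop :=
  ∀ i j, Q.Arrow i j → ξ j = ξ i + 1

/-- `c` is a word of the Coxeter element `φ_Q`: every index occurs exactly once and `c` is
adapted to `Q`. -/
def IsCoxeterWord (Q : DynkinQuiver m) (c : List ℕ) : Prop :=
  c.Perm (List.range' 1 m) ∧ Q.Adapted c

/-- `Q.ARCoord ξ γ i p` means `Ω_Q(γ) = (i,p)`: the root `β_k^{φ_Q}` has coordinate
`(i_k, ξ(i_k))`, and if `β` has coordinate `(i,p)` and `φ_Q(β)` is a positive root, then `φ_Q(β)`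
has coordinate `(i, p-2)`. -/
inductive ARCoord (Q : DynkinQuiver m) (ξ : ℕ → ℤ) : Lattice → ℕ → ℤ → Prop
  | base (c : List ℕ) (hc : Q.IsCoxeterWord c) (k i : ℕ) (β : Lattice) (h : IsLabel c k i β) :
      ARCoord Q ξ β i (ξ i)
  | step (c : List ℕ) (hc : Q.IsCoxeterWord c) (β : Lattice) (i : ℕ) (p : ℤ)
      (h : ARCoord Q ξ β i p) (hpos : act (weyl c) β ∈ posRoots m) :
      ARCoord Q ξ (act (weyl c) β) i (p - 2)

end DynkinQuiver

/-! ### Coordinates in the twisted AR-quiver -/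

/-- The monoid homomorphism `P` from words over `I_{2n+1}` to words over `I_{2n}`:
`i ↦ i` for `i ≤ n`, `n+1 ↦` the empty word, `j ↦ j-1` for `j ≥ n+2`. -/
def projWord (n : ℕ) (w : List ℕ) : List ℕ :=
  w.flatMap (fun i => if i ≤ n then [i] else if i = n + 1 then [] else [i - 1])

/-- `i^+ = i` for `i ≤ n` and `i^+ = i + 1` for `i > n`. -/
def plus (n i : ℕ) : ℕ := if i ≤ n then i else i + 1

/-- `VertexCoord n w Q ξ k i p` means that the vertex at position `k` of the twisted AR-quiver of
`w` has the coordinate `(i,p)`, where `w` projects to a word adapted to `Q`.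
A vertex of residue `≠ n+1` takes its coordinate from the corresponding vertex of `Γ_Q`, the one
of the letter of `projWord n w` which comes from the `k`-th letter of `w`. A vertex of residue
`n+1` is put at distance `1/2` from the vertices that it is joined with by an arrow. -/
inductive VertexCoord (n : ℕ) (w : List ℕ) (Q : DynkinQuiver (2 * n)) (ξ : ℕ → ℤ) :
    ℕ → ℕ → ℚ → Prop
  | induced (k j i : ℕ) (γ : Lattice) (p : ℤ) (hk : w[k]? = some j) (hj : j ≠ n + 1)
      (hγ : IsLabel (projWord n w) (projWord n (w.take k)).length i γ)
      (hp : Q.ARCoord ξ γ i p) :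
      VertexCoord n w Q ξ k (plus n i) p
  | sink (k l j : ℕ) (p : ℚ) (hk : w[k]? = some (n + 1)) (hs : ∀ l', ¬ PosArrow w k l')
      (ha : PosArrow w l k) (hp : VertexCoord n w Q ξ l j p) :
      VertexCoord n w Q ξ k (n + 1) (p + 1 / 2)
  | source (k l j : ℕ) (p : ℚ) (hk : w[k]? = some (n + 1)) (hs : ∀ l', ¬ PosArrow w l' k)
      (ha : PosArrow w k l) (hp : VertexCoord n w Q ξ l j p) :
      VertexCoord n w Q ξ k (n + 1) (p - 1 / 2)
  | middle (k l l' j j' : ℕ) (p : ℚ) (hk : w[k]? = some (n + 1))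
      (ha : PosArrow w l k) (ha' : PosArrow w k l')
      (hj : (j = n ∧ j' = n + 2) ∨ (j = n + 2 ∧ j' = n))
      (hp : VertexCoord n w Q ξ l j p) (hp' : VertexCoord n w Q ξ l' j' (p + 1)) :
      VertexCoord n w Q ξ k (n + 1) (p + 1 / 2)

/-- `Coord n w Q ξ γ i p` means `Ω_{[w]}(γ) = (i,p)`. -/
def Coord (n : ℕ) (w : List ℕ) (Q : DynkinQuiver (2 * n)) (ξ : ℕ → ℤ)
    (γ : Lattice) (i : ℕ) (p : ℚ) : Prop :=
  ∃ k : ℕ, IsLabel w k i γ ∧ VertexCoord n w Q ξ k i p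

/-- Kronecker's `δ_{i,j}`. -/
def delta (i j : ℕ) : ℚ := if i = j then 1 else 0

/-- The residues `j` that contribute to the mesh at residue `i`. -/
def MeshNeighbour (n i j : ℕ) : Prop :=
  if i = n + 2 then j = n ∨ j = n + 3
  else if i = n then j + 1 = n ∨ j = n + 2
  else j + 1 = i ∨ j = i + 1

/-! ### Folding -/

/-- The orbit of `i` under `∨`, represented by its smallest element in `{1, …, n+1}`. -/
def orbitRep (n i : ℕ) : ℕ := min i (vee n i)

/-- The number of indices in the orbit of `i`. -/
def orbitSize (n i : ℕ) : ℕ := ({i, vee n i} : Finset ℕ).card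

/-- The coordinate `(i,s)` in the folded AR-quiver: a root with coordinate `(j, s/2)` in the
twisted AR-quiver gets the coordinate `(orbit of j, s)`. -/
def FoldedCoord (n : ℕ) (w : List ℕ) (Q : DynkinQuiver (2 * n)) (ξ : ℕ → ℤ)
    (γ : Lattice) (i : ℕ) (s : ℤ) : Prop :=
  ∃ j : ℕ, i = orbitRep n j ∧ Coord n w Q ξ γ j ((s : ℚ) / 2)

/-- `γ` lies on a path from `α` to `β` in the twisted (equivalently, folded) AR-quiver. -/
def OnPath (w : List ℕ) (α β γ : Lattice) : Prop :=
  Relation.ReflTransGen (RootArrow w) α γ ∧ Relation.ReflTransGen (RootArrow w) γ β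

end TwistedAR

/-! A word is read against a system of clocks. The letter `i` has a next time `η i`; reading `i`
adds its period, which is `4`, except that the middle letter `n+1` has period `2`. A word is a run
when every letter, at the moment it is read, has a smaller time than its neighbours. An arrow of the
quiver then joins adjacent letters at times `S > T` with `S` less than one period of either letter
after `T`. Residues of the times make this gap `1` at the middle letter and `2` elsewhere. The
coordinate `Ω` of a vertex read at time `T` has second entry `(K - T) / 2` for one global constant
`K`.

The mesh relation comes from fundamental weights. For a prefix `u` let `weight u i` be the image of
`ω_i`. A label is `weight` of its letter before reading minus `weight` after. Since `ω_i + s_i ω_i =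
ω_{i-1} + ω_{i+1}`, two consecutive labels of `i` add up to the total drop of the weights of `i-1`
and `i+1` between the two positions (`At.label_add_label`). The weight of `i` depends only on the
time of `i`, not on the prefix (`weight_eq_of_final_eq`), so these drops can be computed from times
alone. An ordinary neighbour is read exactly once in between and contributes its label
(`CoordRun.weight_sub_plain`). For `i = n` or `n+2` the middle neighbour is read twice. The middle
mesh turns the sum of these two labels into the label of the opposite letter `n+2` or `n`, since `i`
itself is not read between them (`CoordRun.weight_sub_across`). `CoordRun.mesh` collects the cases.

It remains to see that the words in question are such runs. `TwistedRun` holds for the base word and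
survives commutations and reflection functors, because a run of the longest element fills a
fundamental domain of `(i, t) ↦ (i^∨, t + 4n + 2)`. Deleting the middle letter gives a run with all
periods `4`, adapted to `Q`; `AdaptedRun.coord_iff` matches its times with the coordinates in `Γ_Q`.

For the folded form, residues modulo `4` separate `i` from `i^∨`, and time strictly decreases along
arrows, so a path covering half a mesh can end only at a mesh neighbour
(`CoordRun.meshNeighbour_of_path`). -/

namespace TwistedAR

/-! ### Runs

A state assigns to every letter the time at which it is read next. -/

/-- The letter `i` may be read: it comes before its neighbours. -/
def Ready (m : ℕ) (η : ℕ → ℤ) (i : ℕ) : Prop :=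
  1 ≤ i ∧ i ≤ m ∧ ∀ j, 1 ≤ j → j ≤ m → (i = j + 1 ∨ j = i + 1) → η i < η j

/-- The state after reading `i`, where the letter `i` has period `st i`. -/
def bump (st η : ℕ → ℤ) (i : ℕ) : ℕ → ℤ := Function.update η i (η i + st i)

/-- The state after reading the word `u`. -/
def final (st : ℕ → ℤ) : (ℕ → ℤ) → List ℕ → (ℕ → ℤ)
  | η, [] => η
  | η, i :: u => final st (bump st η i) u

/-- Every letter of the word is ready when it is read. -/
def IsRun (m : ℕ) (st : ℕ → ℤ) : (ℕ → ℤ) → List ℕ → Prop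
  | _, [] => True
  | η, i :: u => Ready m η i ∧ IsRun m st (bump st η i) u

/-- The last occurrence of a letter precedes the next occurrences of its neighbours. -/
def Valid (m : ℕ) (st η : ℕ → ℤ) : Prop :=
  ∀ i j, 1 ≤ i → i ≤ m → 1 ≤ j → j ≤ m → (i = j + 1 ∨ j = i + 1) → η i - st i < η j

variable {m : ℕ} {st η : ℕ → ℤ}

theorem bump_self (i : ℕ) : bump st η i i = η i + st i := by simp [bump]

theorem bump_ne {i j : ℕ} (h : j ≠ i) : bump st η i j = η j := by simp [bump, h]

theorem final_append (u v : List ℕ) : final st η (u ++ v) = final st (final st η u) v := by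
  induction u generalizing η with
  | nil => rfl
  | cons i u ih => simpa [final] using ih

theorem isRun_append (u v : List ℕ) :
    IsRun m st η (u ++ v) ↔ IsRun m st η u ∧ IsRun m st (final st η u) v := by
  induction u generalizing η with
  | nil => simp [IsRun, final]
  | cons i u ih => simp [IsRun, final, ih, and_assoc]

/-- Time is a rescaled count of occurrences: this makes states independent of the order of reading
and fixes the class of each clock modulo its period. -/
theorem final_eq_count (u : List ℕ) (j : ℕ) : final st η u j = η j + st j * u.count j := by
  induction u generalizing η with
  | nil => simp [final]
  | cons i u ih =>
    rw [final, ih]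
    rcases eq_or_ne j i with rfl | h
    · rw [bump_self, List.count_cons_self]; push_cast; ring
    · rw [bump_ne h, List.count_cons_of_ne h.symm]

theorem IsRun.mem_range {u : List ℕ} (h : IsRun m st η u) {i : ℕ} (hi : i ∈ u) :
    1 ≤ i ∧ i ≤ m := by
  induction u generalizing η with
  | nil => simp at hi
  | cons a u ih =>
    rcases List.mem_cons.mp hi with rfl | hi
    · exact ⟨h.1.1, h.1.2.1⟩
    · exact ih h.2 hi

theorem Valid.bump (hst : ∀ i, 0 < st i) (hv : Valid m st η) {i : ℕ} (hi : Ready m η i) :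
    Valid m st (bump st η i) := by
  intro a b ha ha' hb hb' hab
  have h1 := hv a b ha ha' hb hb' hab
  have h2 := hst i
  rcases eq_or_ne a i with rfl | hai
  · have : b ≠ a := by omega
    rw [bump_self, bump_ne this]
    have := hi.2.2 b hb hb' hab
    omega
  · rw [bump_ne hai]
    rcases eq_or_ne b i with rfl | hbi
    · rw [bump_self]; omega
    · rwa [bump_ne hbi]

theorem Valid.final (hst : ∀ i, 0 < st i) (hv : Valid m st η) {u : List ℕ}
    (hu : IsRun m st η u) : Valid m st (final st η u) := by
  induction u generalizing η with
  | nil => exact hv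
  | cons i u ih => exact ih (hv.bump hst hu.1) hu.2

theorem Ready.shift {η' : ℕ → ℤ} {d : ℤ} (h : ∀ j, 1 ≤ j → j ≤ m → η' j = η j + d) {i : ℕ}
    (hi : Ready m η i) : Ready m η' i := by
  refine ⟨hi.1, hi.2.1, fun j h1 h2 h3 => ?_⟩
  have := hi.2.2 j h1 h2 h3
  rw [h i hi.1 hi.2.1, h j h1 h2]; omega

/-- Being a run depends only on time differences within the index range. The case `d = 0` replaces a
state by one that agrees with it on that range. -/
theorem IsRun.shift {η' : ℕ → ℤ} {d : ℤ} (h : ∀ j, 1 ≤ j → j ≤ m → η' j = η j + d)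
    {u : List ℕ} (hu : IsRun m st η u) : IsRun m st η' u := by
  induction u generalizing η η' with
  | nil => trivial
  | cons i u ih =>
    refine ⟨hu.1.shift h, ih (fun j h1 h2 => ?_) hu.2⟩
    rcases eq_or_ne j i with rfl | hj
    · rw [bump_self, bump_self, h j h1 h2]; ring
    · rw [bump_ne hj, bump_ne hj, h j h1 h2]

/-! ### Weights -/

theorem act_mul (σ τ : Equiv.Perm ℕ) (v : Lattice) : act (σ * τ) v = act σ (act τ v) := by
  ext x; simp [act]

theorem act_add (σ : Equiv.Perm ℕ) (v w : Lattice) : act σ (v + w) = act σ v + act σ w := rfl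

theorem act_sub (σ : Equiv.Perm ℕ) (v w : Lattice) : act σ (v - w) = act σ v - act σ w := rfl

theorem act_single (σ : Equiv.Perm ℕ) (a : ℕ) (z : ℤ) :
    act σ (Pi.single a z) = Pi.single (σ a) z := by
  ext x
  simp only [act, Pi.single_apply]
  congr 1
  rw [Equiv.Perm.inv_eq_iff_eq, eq_comm, eq_comm (a := x)]

theorem act_simpleRoot (σ : Equiv.Perm ℕ) (i : ℕ) :
    act σ (simpleRoot i) = Pi.single (σ i) 1 - Pi.single (σ (i + 1)) 1 := by
  rw [simpleRoot, act_sub, act_single, act_single]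

theorem weyl_append (u v : List ℕ) : weyl (u ++ v) = weyl u * weyl v := by simp [weyl]

theorem weyl_singleton (i : ℕ) : weyl [i] = Equiv.swap i (i + 1) := by simp [weyl]

/-- The fundamental weight `e_1 + ⋯ + e_i`. -/
def fundWeight (i : ℕ) : Lattice := fun x => if 1 ≤ x ∧ x ≤ i then 1 else 0

/-- The image of the `i`-th fundamental weight under the Weyl group element of `u`. -/
def weight (u : List ℕ) (i : ℕ) : Lattice := act (weyl u) (fundWeight i)

theorem weight_append_ne {i j : ℕ} (hj : 1 ≤ j) (h : j ≠ i) (v : List ℕ) :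
    weight (v ++ [j]) i = weight v i := by
  rw [weight, weyl_append, act_mul, weyl_singleton, weight]
  congr 1
  ext x
  simp only [act, fundWeight, Equiv.swap_inv, Equiv.swap_apply_def]
  split_ifs <;> omega

theorem fundWeight_sub (i : ℕ) (hi : 1 ≤ i) :
    fundWeight i - act (Equiv.swap i (i + 1)) (fundWeight i) = simpleRoot i := by
  ext x
  simp only [act, fundWeight, Equiv.swap_inv, Equiv.swap_apply_def, Pi.sub_apply, simpleRoot,
    Pi.single_apply]
  split_ifs <;> omega

/-- This is `2ω_i - α_i = ω_{i-1} + ω_{i+1}`, the source of all mesh relations. It is exact in this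
lattice, with `ω_0 = 0`, because `ω_i = e_1 + ⋯ + e_i`. -/
theorem fundWeight_add (i : ℕ) (hi : 1 ≤ i) :
    fundWeight i + act (Equiv.swap i (i + 1)) (fundWeight i) =
      fundWeight (i - 1) + fundWeight (i + 1) := by
  ext x
  simp only [act, fundWeight, Equiv.swap_inv, Equiv.swap_apply_def, Pi.add_apply]
  split_ifs <;> omega

theorem label_eq_weight_sub {i : ℕ} (hi : 1 ≤ i) (v : List ℕ) :
    act (weyl v) (simpleRoot i) = weight v i - weight (v ++ [i]) i := by
  rw [weight, weight, weyl_append, act_mul, weyl_singleton, ← act_sub, fundWeight_sub i hi]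

theorem weight_add_append {i : ℕ} (hi : 1 ≤ i) (v : List ℕ) :
    weight v i + weight (v ++ [i]) i = weight v (i - 1) + weight v (i + 1) := by
  simp only [weight, weyl_append, act_mul, weyl_singleton, ← act_add, fundWeight_add i hi]

/-- The next occurrences of the neighbours are determined by the time of a letter that is read. -/
theorem final_eq_of_ready (hst : ∀ i, 0 < st i) (hv : Valid m st η) {v v' : List ℕ}
    (hr : IsRun m st η v) (hr' : IsRun m st η v') {i j : ℕ}
    (hi : Ready m (final st η v) i) (hi' : Ready m (final st η v') i)
    (he : final st η v i = final st η v' i) (hij : i = j + 1 ∨ j = i + 1) :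
    final st η v j = final st η v' j := by
  -- With `T` the common time of `i`, both times of `j` lie strictly between `T` and `T + st j` or
  -- at least in a window no longer than one period, and they are congruent modulo `st j`. Outside
  -- the index range `j` is never read.
  by_cases hj : 1 ≤ j ∧ j ≤ m
  · have a1 := hi.2.2 j hj.1 hj.2 hij
    have a2 := hi'.2.2 j hj.1 hj.2 hij
    have b1 := hv.final hst hr j i hj.1 hj.2 hi.1 hi.2.1 hij.symm
    have b2 := hv.final hst hr' j i hj.1 hj.2 hi.1 hi.2.1 hij.symm
    have c := hst j
    have d1 := final_eq_count (st := st) (η := η) v j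
    have d2 := final_eq_count (st := st) (η := η) v' j
    rcases lt_trichotomy (v.count j) (v'.count j) with h | h | h
    · have : (v.count j : ℤ) + 1 ≤ v'.count j := by exact_mod_cast h
      nlinarith
    · rw [d1, d2, h]
    · have : (v'.count j : ℤ) + 1 ≤ v.count j := by exact_mod_cast h
      nlinarith
  · rw [final_eq_count, final_eq_count, List.count_eq_zero_of_not_mem,
      List.count_eq_zero_of_not_mem]
    · exact fun h => hj (hr'.mem_range h)
    · exact fun h => hj (hr.mem_range h)

/-- In runs from the same state, weights only depend on the time. -/
theorem weight_eq_of_final_eq (hst : ∀ i, 0 < st i) (hv : Valid m st η) :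
    ∀ (N : ℕ) (u u' : List ℕ), u.length + u'.length = N → IsRun m st η u → IsRun m st η u' →
      ∀ i, final st η u i = final st η u' i → weight u i = weight u' i := by
  intro N
  induction N using Nat.strong_induction_on with
  | _ N ih =>
  intro u u' hN hu hu' i he
  -- A word ending in `i` has strictly advanced the clock of `i`, so it cannot agree at `i` with the
  -- empty word. Final letters other than `i` change neither the time nor the weight of `i` and are
  -- stripped.
  have hpos : ∀ x : List ℕ, η i + st i ≤ final st η (x ++ [i]) i := by
    intro x
    rw [final_eq_count]
    have : (1 : ℤ) ≤ (x ++ [i]).count i := by simp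
    nlinarith [hst i]
  have hne : ∀ (x : List ℕ) (j : ℕ), j ≠ i → final st η (x ++ [j]) i = final st η x i := by
    intro x j hj
    rw [final_append]
    exact bump_ne hj.symm
  rcases List.eq_nil_or_concat u with rfl | ⟨v, j, rfl⟩
  · rcases List.eq_nil_or_concat u' with rfl | ⟨v', j', rfl⟩
    · rfl
    · rw [List.concat_eq_append] at *
      have hv' := (isRun_append _ _).mp hu'
      by_cases hj : j' = i
      · subst hj
        have h1 := hpos v'
        have h2 := hst j'
        simp only [final] at he
        omega
      · rw [weight_append_ne hv'.2.1.1 hj]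
        refine ih _ ?_ [] v' rfl trivial hv'.1 i ?_
        · simp at hN; simp; omega
        · rw [he, hne _ _ hj]
  · rw [List.concat_eq_append] at *
    have hv1 := (isRun_append _ _).mp hu
    by_cases hj : j = i
    · subst hj
      rcases List.eq_nil_or_concat u' with rfl | ⟨v', j', rfl⟩
      · have h1 := hpos v
        have h2 := hst j
        simp only [final] at he
        rw [he] at h1
        omega
      · rw [List.concat_eq_append] at *
        have hv' := (isRun_append _ _).mp hu'
        simp only [List.length_append, List.length_singleton] at hN
        by_cases hj' : j' = j
        · subst hj'
          -- Both words end in the letter in question. Before it, the times of this letter agree,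
          -- hence so do those of its neighbours; induction gives the three weights before the last
          -- step, and the mesh identity determines the one after it.
          have hij : final st η v j' = final st η v' j' := by
            rw [final_append, final_append] at he
            simp only [final, bump_self] at he
            omega
          have r1 : Ready m (final st η v) j' := hv1.2.1
          have r2 : Ready m (final st η v') j' := hv'.2.1
          have e1 := ih _ (by omega) v v' rfl hv1.1 hv'.1 j' hij
          have e2 := ih _ (by omega) v v' rfl hv1.1 hv'.1 (j' - 1)
            (final_eq_of_ready hst hv hv1.1 hv'.1 r1 r2 hij (by have := r1.1; omega))
          have e3 := ih _ (by omega) v v' rfl hv1.1 hv'.1 (j' + 1)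
            (final_eq_of_ready hst hv hv1.1 hv'.1 r1 r2 hij (by omega))
          have f1 := weight_add_append r1.1 v
          have f2 := weight_add_append r1.1 v'
          rw [e1, e2, e3, ← f2] at f1
          exact add_left_cancel f1
        · rw [weight_append_ne hv'.2.1.1 hj']
          refine ih _ ?_ (v ++ [j]) v' rfl hu hv'.1 j ?_
          · simp; omega
          · rw [he, hne _ _ hj']
    · rw [weight_append_ne hv1.2.1.1 hj]
      refine ih _ ?_ v u' rfl hv1.1 hu' i ?_
      · simp at hN; omega
      · rw [← he, hne _ _ hj]

theorem weight_eq (hst : ∀ i, 0 < st i) (hv : Valid m st η) {u u' : List ℕ}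
    (hu : IsRun m st η u) (hu' : IsRun m st η u') {i : ℕ}
    (he : final st η u i = final st η u' i) : weight u i = weight u' i :=
  weight_eq_of_final_eq hst hv _ u u' rfl hu hu' i he

/-- In runs from the same state, labels only depend on the letter and the time. -/
theorem label_eq (hst : ∀ i, 0 < st i) (hv : Valid m st η) {u u' : List ℕ} {i : ℕ}
    (hu : IsRun m st η (u ++ [i])) (hu' : IsRun m st η (u' ++ [i]))
    (he : final st η u i = final st η u' i) :
    act (weyl u) (simpleRoot i) = act (weyl u') (simpleRoot i) := by
  have h1 := (isRun_append _ _).mp hu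
  have h2 := (isRun_append _ _).mp hu'
  rw [label_eq_weight_sub h1.2.1.1, label_eq_weight_sub h1.2.1.1,
    weight_eq hst hv h1.1 h2.1 he, weight_eq hst hv hu hu']
  rw [final_append, final_append]
  simp only [final, bump_self, he]

/-! ### Reduced words of the longest element -/

theorem sum_simpleRoot {a b : ℕ} (h : a ≤ b) :
    ∑ k ∈ Finset.Icc a b, simpleRoot k = Pi.single a 1 - Pi.single (b + 1) 1 := by
  induction b, h using Nat.le_induction with
  | base => simp [simpleRoot]
  | succ b h ih =>
    rw [← Finset.insert_Icc_right_eq_Icc_add_one (by omega), Finset.sum_insert (by simp), ih, simpleRoot]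
    abel

theorem mem_posRoots {m : ℕ} {γ : Lattice} : γ ∈ posRoots m ↔
    ∃ a b, 1 ≤ a ∧ a < b ∧ b ≤ m + 1 ∧ γ = Pi.single a 1 - Pi.single b 1 := by
  simp only [posRoots, Finset.mem_image, Finset.mem_filter, Finset.mem_product, Finset.mem_Icc,
    Prod.exists]
  constructor
  · rintro ⟨a, b, ⟨⟨⟨h1, h2⟩, h3, h4⟩, h5⟩, rfl⟩
    exact ⟨a, b + 1, h1, by omega, by omega, sum_simpleRoot h5⟩
  · rintro ⟨a, b, h1, h2, h3, rfl⟩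
    refine ⟨a, b - 1, ⟨⟨⟨h1, by omega⟩, by omega, by omega⟩, by omega⟩, ?_⟩
    rw [sum_simpleRoot (by omega), Nat.sub_add_cancel (by omega)]

theorem neg_notMem_posRoots {m : ℕ} {γ : Lattice} (h : γ ∈ posRoots m) : -γ ∉ posRoots m := by
  rw [mem_posRoots] at *
  obtain ⟨a, b, h1, h2, h3, rfl⟩ := h
  rintro ⟨c, d, h4, h5, h6, h⟩
  have e1 := congrFun h c
  have e2 := congrFun h d
  simp only [Pi.neg_apply, Pi.sub_apply, Pi.single_apply] at e1 e2
  split_ifs at e1 e2 <;> omega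

theorem single_sub_single_injective {a b c d : ℕ} (hab : a < b)
    (h : (Pi.single a 1 - Pi.single b 1 : Lattice) = Pi.single c 1 - Pi.single d 1) :
    a = c ∧ b = d := by
  have hac : a = c := by
    have e := congrFun h a
    simp only [Pi.sub_apply, Pi.single_apply] at e
    split_ifs at e <;> omega
  have hbd : b = d := by
    have e := congrFun h b
    simp only [Pi.sub_apply, Pi.single_apply] at e
    split_ifs at e <;> omega
  exact ⟨hac, hbd⟩

-- Only the lower bound is needed: the labels of a word of this length already cover the positive
-- roots, and the count then makes the labelling bijective.
open scoped Classical in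
theorem card_posRoots (m : ℕ) : m * (m + 1) ≤ 2 * (posRoots m).card := by
  have hinj : (((Finset.range (m + 1)).sigma fun b => Finset.range b).image
      fun x => (Pi.single (x.2 + 1) 1 - Pi.single (x.1 + 1) 1 : Lattice)) ⊆ posRoots m := by
    intro γ hγ
    simp only [Finset.mem_image, Finset.mem_sigma, Finset.mem_range, Sigma.exists] at hγ
    obtain ⟨b, a, ⟨h1, h2⟩, rfl⟩ := hγ
    exact mem_posRoots.mpr ⟨a + 1, b + 1, by omega, by omega, by omega, rfl⟩
  have h := Finset.card_le_card hinj
  rw [Finset.card_image_of_injOn, Finset.card_sigma] at h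
  · simp only [Finset.card_range] at h
    have := Finset.sum_range_id_mul_two (m + 1)
    simp only [Nat.add_sub_cancel] at this
    nlinarith
  · rintro ⟨b, a⟩ hx ⟨b', a'⟩ hy hxy
    simp only [Finset.coe_sigma, Set.mem_sigma_iff, Finset.mem_coe, Finset.mem_range] at hx hy
    have := single_sub_single_injective (a := a + 1) (b := b + 1) (c := a' + 1) (d := b' + 1)
      (by omega) hxy
    obtain ⟨rfl, rfl⟩ : b = b' ∧ a = a' := by omega
    rfl

/-- `σ` acts on `{1, …, m+1}` as the longest element of type `A_m`. -/
def IsLongest (m : ℕ) (σ : Equiv.Perm ℕ) : Prop := ∀ x, 1 ≤ x → x ≤ m + 1 → σ x = m + 2 - x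

theorem weyl_take_succ {w : List ℕ} {k i : ℕ} (h : w[k]? = some i) :
    weyl (w.take (k + 1)) = weyl (w.take k) * Equiv.swap i (i + 1) := by
  rw [List.take_add_one, h, weyl_append]
  simp [weyl]

theorem weyl_mapsTo {m : ℕ} {w : List ℕ} (hw : ∀ i ∈ w, 1 ≤ i ∧ i ≤ m) {x : ℕ} (h1 : 1 ≤ x)
    (h2 : x ≤ m + 1) : 1 ≤ weyl w x ∧ weyl w x ≤ m + 1 := by
  induction w with
  | nil => simpa [weyl] using ⟨h1, h2⟩
  | cons i w ih =>
    have h := ih fun j hj => hw j (List.mem_cons_of_mem _ hj)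
    have hi := hw i List.mem_cons_self
    have : weyl (i :: w) x = Equiv.swap i (i + 1) (weyl w x) := by simp [weyl]
    rw [this, Equiv.swap_apply_def]
    split_ifs <;> omega

/-- The longest element inverts the pair `a < b`. The prefix at which the order of the preimages of
`a` and `b` first flips ends in a letter whose label is `e_a - e_b`. -/
theorem exists_label_eq {m : ℕ} {w : List ℕ} (hl : IsLongest m (weyl w)) {a b : ℕ} (ha : 1 ≤ a) (hab : a < b) (hb : b ≤ m + 1) :
    ∃ k i, w[k]? = some i ∧ act (weyl (w.take k)) (simpleRoot i) =
      Pi.single a 1 - Pi.single b 1 := by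
  by_contra! hcon
  have key : ∀ k, (weyl (w.take k))⁻¹ a < (weyl (w.take k))⁻¹ b := by
    intro k
    induction k with
    | zero => simpa [weyl] using hab
    | succ k ih =>
      rcases h : w[k]? with _ | i
      · rw [List.take_add_one, h]; simpa using ih
      · have hc := hcon k i h
        rw [weyl_take_succ h]
        set σ := weyl (w.take k)
        rw [act_simpleRoot] at hc
        -- An adjacent transposition reverses the order of two preimages only if they are exactly
        -- `i` and `i + 1`, in which case the label would be `e_a - e_b`.
        have hne : ¬ (σ⁻¹ a = i ∧ σ⁻¹ b = i + 1) := by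
          rintro ⟨h1, h2⟩
          rw [Equiv.Perm.inv_eq_iff_eq] at h1 h2
          exact hc (by rw [← h1, ← h2])
        simp only [mul_inv_rev, Equiv.swap_inv, Equiv.Perm.mul_apply, Equiv.swap_apply_def]
        split_ifs <;> omega
  have h := key w.length
  rw [List.take_length] at h
  have e : ∀ x, 1 ≤ x → x ≤ m + 1 → (weyl w)⁻¹ x = m + 2 - x := by
    intro x h1 h2
    rw [Equiv.Perm.inv_eq_iff_eq, hl _ (by omega) (by omega)]
    omega
  rw [e a ha (by omega), e b (by omega) hb] at h
  omega

/-- A word of the longest element whose length is the number of positive roots. -/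
structure IsReducedLongest (m : ℕ) (w : List ℕ) : Prop where
  mem_range : ∀ i ∈ w, 1 ≤ i ∧ i ≤ m
  longest : IsLongest m (weyl w)
  two_mul_length : 2 * w.length = m * (m + 1)

-- All positive roots occur as labels, and there are as many positions as positive roots, so every
-- label is positive and none repeats. The default `0` in `getD` is never reached for positions in
-- the range.
open scoped Classical in
theorem posRoots_labels {m : ℕ} {w : List ℕ} (hw : IsReducedLongest m w) :
    posRoots m = (Finset.range w.length).image
      (fun k => act (weyl (w.take k)) (simpleRoot (w[k]?.getD 0))) ∧
    Set.InjOn (fun k => act (weyl (w.take k)) (simpleRoot (w[k]?.getD 0)))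
      (Finset.range w.length : Set ℕ) := by
  set f := fun k => act (weyl (w.take k)) (simpleRoot (w[k]?.getD 0)) with hf
  have hsub : posRoots m ⊆ (Finset.range w.length).image f := by
    intro γ hγ
    obtain ⟨a, b, h1, h2, h3, rfl⟩ := mem_posRoots.mp hγ
    obtain ⟨k, i, hk, h⟩ := exists_label_eq hw.longest h1 h2 h3
    refine Finset.mem_image.mpr ⟨k, ?_, ?_⟩
    · exact Finset.mem_range.mpr (List.getElem?_eq_some_iff.mp hk).1
    · simpa [hf, hk] using h
  have hcard := card_posRoots m
  have hlen := hw.two_mul_length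
  have hle := Finset.card_image_le (s := Finset.range w.length) (f := f)
  rw [Finset.card_range] at hle
  have heq := Finset.eq_of_subset_of_card_le hsub (by omega)
  refine ⟨heq, Finset.card_image_iff.mp ?_⟩
  rw [← heq, Finset.card_range]
  have := Finset.card_le_card hsub
  omega

open scoped Classical in
theorem IsReducedLongest.label_mem {m : ℕ} {w : List ℕ} (hw : IsReducedLongest m w)
    {k i : ℕ} {γ : Lattice} (h : IsLabel w k i γ) : γ ∈ posRoots m := by
  rw [(posRoots_labels hw).1]
  refine Finset.mem_image.mpr ⟨k, ?_, ?_⟩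
  · exact Finset.mem_range.mpr (List.getElem?_eq_some_iff.mp h.1).1
  · simp [h.1, h.2]

theorem IsReducedLongest.label_injective {m : ℕ} {w : List ℕ} (hw : IsReducedLongest m w)
    {k k' i i' : ℕ} {γ : Lattice} (h : IsLabel w k i γ) (h' : IsLabel w k' i' γ) :
    k = k' ∧ i = i' := by
  have : k = k' := by
    refine (posRoots_labels hw).2 ?_ ?_ ?_
    · exact Finset.mem_coe.mpr (Finset.mem_range.mpr (List.getElem?_eq_some_iff.mp h.1).1)
    · exact Finset.mem_coe.mpr (Finset.mem_range.mpr (List.getElem?_eq_some_iff.mp h'.1).1)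
    · simp [h.1, h'.1, ← h.2, ← h'.2]
  subst this
  have := h.1.symm.trans h'.1
  simpa using this

/-! ### Commutation and reflection -/

theorem weyl_commStep {u v : List ℕ} {i j : ℕ} (h : i + 1 < j ∨ j + 1 < i) :
    weyl (u ++ [i, j] ++ v) = weyl (u ++ [j, i] ++ v) := by
  rw [weyl_append, weyl_append, weyl_append, weyl_append]
  congr 2
  ext x
  simp only [weyl, List.map_cons, List.map_nil, List.prod_cons, List.prod_nil, mul_one,
    Equiv.Perm.mul_apply, Equiv.swap_apply_def]
  split_ifs <;> omega

/-- The longest element satisfies `s_i w₀ = w₀ s_{i^*}` with `i^* = m + 1 - i`. -/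
theorem isLongest_rotate_left {m : ℕ} {u : List ℕ} {i j : ℕ} (h1 : 1 ≤ i) (h2 : i ≤ m)
    (hj : j = m + 1 - i) (h : IsLongest m (weyl ([i] ++ u))) : IsLongest m (weyl (u ++ [j])) := by
  intro x hx hx'
  have e : weyl u (Equiv.swap j (j + 1) x) =
      Equiv.swap i (i + 1) (weyl ([i] ++ u) (Equiv.swap j (j + 1) x)) := by
    rw [weyl_append, weyl_singleton, Equiv.Perm.mul_apply, Equiv.swap_apply_self]
  rw [weyl_append, weyl_singleton, Equiv.Perm.mul_apply, e, h]
  · simp only [Equiv.swap_apply_def]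
    split_ifs <;> omega
  · rw [Equiv.swap_apply_def]; split_ifs <;> omega
  · rw [Equiv.swap_apply_def]; split_ifs <;> omega

theorem isLongest_rotate_right {m : ℕ} {u : List ℕ} {i j : ℕ} (h1 : 1 ≤ i) (h2 : i ≤ m)
    (hj : j = m + 1 - i) (h : IsLongest m (weyl (u ++ [i]))) : IsLongest m (weyl ([j] ++ u)) := by
  intro x hx hx'
  have e : weyl u x = weyl (u ++ [i]) (Equiv.swap i (i + 1) x) := by
    rw [weyl_append, weyl_singleton, Equiv.Perm.mul_apply, Equiv.swap_apply_self]
  rw [weyl_append, weyl_singleton, Equiv.Perm.mul_apply, e, h]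
  · simp only [Equiv.swap_apply_def]
    split_ifs <;> omega
  · rw [Equiv.swap_apply_def]; split_ifs <;> omega
  · rw [Equiv.swap_apply_def]; split_ifs <;> omega

theorem IsReducedLongest.rotate_left {m : ℕ} {u : List ℕ} {i j : ℕ} (hj : j = m + 1 - i)
    (h : IsReducedLongest m ([i] ++ u)) : IsReducedLongest m (u ++ [j]) := by
  have hi := h.mem_range i (by simp)
  refine ⟨fun a ha => ?_, isLongest_rotate_left hi.1 hi.2 hj h.longest, ?_⟩
  · rcases List.mem_append.mp ha with ha | ha
    · exact h.mem_range a (by simp [ha])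
    · rw [List.mem_singleton] at ha; omega
  · rw [← h.two_mul_length]; simp

theorem IsReducedLongest.rotate_right {m : ℕ} {u : List ℕ} {i j : ℕ} (hj : j = m + 1 - i)
    (h : IsReducedLongest m (u ++ [i])) : IsReducedLongest m ([j] ++ u) := by
  have hi := h.mem_range i (by simp)
  refine ⟨fun a ha => ?_, isLongest_rotate_right hi.1 hi.2 hj h.longest, ?_⟩
  · rcases List.mem_append.mp ha with ha | ha
    · rw [List.mem_singleton] at ha; omega
    · exact h.mem_range a (by simp [ha])
  · rw [← h.two_mul_length]; simp

theorem IsReducedLongest.commStep {m : ℕ} {u v : List ℕ} {i j : ℕ}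
    (hij : i + 1 < j ∨ j + 1 < i) (h : IsReducedLongest m (u ++ [i, j] ++ v)) :
    IsReducedLongest m (u ++ [j, i] ++ v) := by
  refine ⟨fun a ha => h.mem_range a ?_, ?_, ?_⟩
  · simp at ha ⊢; tauto
  · rw [← weyl_commStep hij]; exact h.longest
  · rw [← h.two_mul_length]; simp

/-! ### The base word -/

theorem weyl_range' (m x : ℕ) : weyl (List.range' 1 m) x =
    if 1 ≤ x ∧ x ≤ m then x + 1 else if x = m + 1 then 1 else x := by
  induction m generalizing x with
  | zero => simp [weyl]; split_ifs <;> omega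
  | succ m ih =>
    rw [List.range'_concat, weyl_append, weyl_singleton, Equiv.Perm.mul_apply, ih,
      Equiv.swap_apply_def]
    split_ifs <;> omega

theorem weyl_range'_reverse (L m x : ℕ) (hm : m ≤ L) :
    weyl ((List.range' 1 m).map (fun i => L + 1 - i)) x =
    if x = L + 1 - m then L + 1 else if L + 1 - m < x ∧ x ≤ L + 1 then x - 1 else x := by
  induction m generalizing x with
  | zero => simp [weyl]; split_ifs <;> omega
  | succ m ih =>
    rw [List.range'_concat, List.map_append, weyl_append, Equiv.Perm.mul_apply, ih _ (by omega),
      List.map_singleton, weyl_singleton, Equiv.swap_apply_def]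
    split_ifs <;> omega

/-- The word `1 2 ⋯ m` or its image under `i ↦ L + 1 - i`, according to the parity of `k`. -/
def block (L m k : ℕ) : List ℕ :=
  if Even k then List.range' 1 m else (List.range' 1 m).map (fun i => L + 1 - i)

/-- The rank is `n + m`, so `m = n + 1` treats the base word in type `A_{2n+1}` and `m = n` its
projection in type `A_{2n}` at once. Two blocks form one step of an explicit permutation, which
makes the induction on `k` a case check. -/
theorem weyl_blocks_even {n m : ℕ} (h1 : n ≤ m) (h2 : m ≤ n + 1) (k : ℕ) (hk : k ≤ n) (x : ℕ)
    (hx : 1 ≤ x) (hx' : x ≤ n + m + 1) :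
    weyl ((List.range (2 * k)).flatMap (block (n + m) m)) x =
      if x ≤ n + 1 then (if x + k ≤ n + 1 then x + k else 2 * n + m + 3 - x - k)
      else if m + 2 ≤ x then (if m + 2 ≤ x - k then x - k else m + 2 + k - x) else x := by
  induction k generalizing x with
  | zero => simp [weyl]; split_ifs <;> omega
  | succ k ih =>
    have e : 2 * (k + 1) = 2 * k + 1 + 1 := by ring
    rw [e, List.range_succ, List.range_succ, List.flatMap_append, List.flatMap_append,
      weyl_append, weyl_append, Equiv.Perm.mul_apply, Equiv.Perm.mul_apply]
    have b1 : (([2 * k + 1] : List ℕ).flatMap (block (n + m) m)) =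
        (List.range' 1 m).map (fun i => n + m + 1 - i) := by
      simp [block]
    have b2 : (([2 * k] : List ℕ).flatMap (block (n + m) m)) = List.range' 1 m := by
      simp [block]
    rw [b1, b2, weyl_range'_reverse _ _ _ (by omega), weyl_range', ih (by omega)]
    · split_ifs <;> omega
    · split_ifs <;> omega
    · split_ifs <;> omega

theorem isReducedLongest_blocks {n m : ℕ} (h1 : n ≤ m) (h2 : m ≤ n + 1) :
    IsReducedLongest (n + m) ((List.range (2 * n + 1)).flatMap (block (n + m) m)) := by
  refine ⟨fun i hi => ?_, fun x hx hx' => ?_, ?_⟩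
  · rw [List.mem_flatMap] at hi
    obtain ⟨k, _, hi⟩ := hi
    rw [block] at hi
    split_ifs at hi
    · rw [List.mem_range'_1] at hi; omega
    · rw [List.mem_map] at hi
      obtain ⟨a, ha, rfl⟩ := hi
      rw [List.mem_range'_1] at ha; omega
  · have b2 : (([2 * n] : List ℕ).flatMap (block (n + m) m)) = List.range' 1 m := by
      simp [block]
    rw [List.range_succ, List.flatMap_append, weyl_append, Equiv.Perm.mul_apply, b2, weyl_range',
      weyl_blocks_even h1 h2 n le_rfl]
    · split_ifs <;> omega
    · split_ifs <;> omega
    · split_ifs <;> omega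
  · have : ∀ k, (block (n + m) m k).length = m := by
      intro k; rw [block]; split_ifs <;> simp
    rw [List.length_flatMap]
    simp only [this, List.map_const', List.length_range, List.sum_replicate, smul_eq_mul]
    obtain rfl | rfl : m = n ∨ m = n + 1 := by omega
    · ring
    · ring

/-! ### Invariants of the twisted adapted cluster point -/

/-- The periods of the letters in the twisted AR-quiver. -/
def twistedStep (n : ℕ) : ℕ → ℤ := fun i => if i = n + 1 then 2 else 4

theorem twistedStep_pos (n i : ℕ) : 0 < twistedStep n i := by
  rw [twistedStep]; split_ifs <;> norm_num

/-- The residue classes of the times of the letters. -/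
def Residues (n : ℕ) (τ : ℕ → ℤ) : Prop :=
  ∀ i : ℕ, 1 ≤ i → i ≤ 2 * n + 1 → (i ≤ n → τ i % 4 = (2 * i) % 4) ∧ (i = n + 1 → τ i % 2 = 1) ∧
    (n + 2 ≤ i → τ i % 4 = (2 * i + 2) % 4)

theorem Residues.add {n : ℕ} {τ τ' : ℕ → ℤ} (h : Residues n τ)
    (h' : ∀ i, ∃ z : ℤ, τ' i = τ i + twistedStep n i * z) : Residues n τ' := by
  intro i h1 h2
  have h3 := h i h1 h2
  obtain ⟨z, hz⟩ := h' i
  rw [twistedStep] at hz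
  split_ifs at hz <;> omega

theorem Residues.bump {n : ℕ} {τ : ℕ → ℤ} (h : Residues n τ) (i : ℕ) :
    Residues n (bump (twistedStep n) τ i) := by
  refine h.add fun j => ?_
  rcases eq_or_ne j i with rfl | hj
  · exact ⟨1, by rw [bump_self, mul_one]⟩
  · exact ⟨0, by rw [bump_ne hj]; ring⟩

theorem Residues.final {n : ℕ} {τ : ℕ → ℤ} (h : Residues n τ) (u : List ℕ) :
    Residues n (final (twistedStep n) τ u) :=
  h.add fun j => ⟨_, final_eq_count u j⟩

/-- The word `w` is read from the state `τ` and fills a fundamental domain of the translation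
`(i, t) ↦ (i^∨, t + 4n + 2)`. -/
structure TwistedRun (n : ℕ) (τ : ℕ → ℤ) (w : List ℕ) : Prop where
  run : IsRun (2 * n + 1) (twistedStep n) τ w
  valid : Valid (2 * n + 1) (twistedStep n) τ
  residues : Residues n τ
  symm : ∀ i, 1 ≤ i → i ≤ 2 * n + 1 → final (twistedStep n) τ w (vee n i) = τ i + (4 * n + 2)
  reduced : IsReducedLongest (2 * n + 1) w
  reduced_proj : IsReducedLongest (2 * n) (projWord n w)

theorem twistedStep_vee {n i : ℕ} (h2 : i ≤ 2 * n + 1) :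
    twistedStep n (vee n i) = twistedStep n i := by
  simp only [twistedStep, vee]
  split_ifs <;> omega

theorem vee_vee {n i : ℕ} (h : i ≤ 2 * n + 1) : vee n (vee n i) = i := by
  simp only [vee]; omega

theorem projWord_append (n : ℕ) (u v : List ℕ) :
    projWord n (u ++ v) = projWord n u ++ projWord n v := by
  simp [projWord]

/-- The letters `n` and `n+2` commute, but their projections `n` and `n+1` are adjacent; this is the
only pair for which a commutation is not preserved, and `Valid.not_both_ready` excludes it in a run.
-/
theorem projWord_pair_swap {n i j : ℕ} (hi : 1 ≤ i) (hj : 1 ≤ j)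
    (h : i + 1 < j ∨ j + 1 < i)
    (h' : ¬ (i = n ∧ j = n + 2) ∧ ¬ (j = n ∧ i = n + 2)) :
    projWord n [i, j] = projWord n [j, i] ∨ ∃ a b, (a + 1 < b ∨ b + 1 < a) ∧
      projWord n [i, j] = [a, b] ∧ projWord n [j, i] = [b, a] := by
  simp only [projWord, List.flatMap_cons, List.flatMap_nil, List.append_nil]
  by_cases h1 : i = n + 1
  · left; simp [h1]
  by_cases h2 : j = n + 1
  · left; simp [h2]
  right
  refine ⟨if i ≤ n then i else i - 1, if j ≤ n then j else j - 1, ?_, ?_, ?_⟩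
  · split_ifs <;> omega
  · split_ifs <;> simp
  · split_ifs <;> simp

theorem projWord_singleton {n i : ℕ} :
    projWord n [i] = if i ≤ n then [i] else if i = n + 1 then [] else [i - 1] := by
  simp [projWord]

theorem projWord_vee {n i : ℕ} (h1 : 1 ≤ i) (h2 : i ≤ 2 * n + 1) :
    (projWord n [i] = [] ∧ projWord n [vee n i] = []) ∨ ∃ a, projWord n [i] = [a] ∧
      projWord n [vee n i] = [2 * n + 1 - a] := by
  rw [projWord_singleton, projWord_singleton, vee]
  by_cases h : i = n + 1
  · left; subst h
    split_ifs <;> first | omega | simp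
  right
  refine ⟨if i ≤ n then i else i - 1, ?_, ?_⟩
  · split_ifs <;> simp
  · split_ifs <;> first | omega | (simp; try omega)

theorem Ready.ne_adjacent {m : ℕ} {st η : ℕ → ℤ} {i j : ℕ} (hij : i + 1 < j ∨ j + 1 < i)
    (h : Ready m (bump st η i) j) : Ready m η j := by
  refine ⟨h.1, h.2.1, fun k h1 h2 h3 => ?_⟩
  have := h.2.2 k h1 h2 h3
  rwa [bump_ne (by omega), bump_ne (by omega)] at this

theorem Ready.bump {m : ℕ} {st η : ℕ → ℤ} {i j : ℕ} (hij : i + 1 < j ∨ j + 1 < i)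
    (h : Ready m η j) : Ready m (bump st η i) j := by
  refine ⟨h.1, h.2.1, fun k h1 h2 h3 => ?_⟩
  rw [bump_ne (by omega), bump_ne (by omega)]
  exact h.2.2 k h1 h2 h3

/-- If `n` and `n+2` were both ready, the period `2` of the middle letter would force both times to
be `τ (n+1) - 1`, while their residues modulo `4` differ by `2`. -/
theorem Valid.not_both_ready {n : ℕ} {τ : ℕ → ℤ} (hv : Valid (2 * n + 1) (twistedStep n) τ)
    (hr : Residues n τ) {i j : ℕ} (hi : Ready (2 * n + 1) τ i) (hj : Ready (2 * n + 1) τ j) :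
    ¬ (i = n ∧ j = n + 2) ∧ ¬ (j = n ∧ i = n + 2) := by
  suffices h : ∀ a b, Ready (2 * n + 1) τ a → Ready (2 * n + 1) τ b → ¬ (a = n ∧ b = n + 2) from
    ⟨h i j hi hj, h j i hj hi⟩
  rintro a b ha hb ⟨e1, e2⟩
  rw [e1] at ha
  rw [e2] at hb
  obtain ⟨a1, a2, a3⟩ := ha
  obtain ⟨b1, b2, b3⟩ := hb
  have c1 := a3 (n + 1) (by omega) (by omega) (by omega)
  have c2 := b3 (n + 1) (by omega) (by omega) (by omega)
  have c3 := hv (n + 1) n (by omega) (by omega) a1 a2 (by omega)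
  have c4 := hv (n + 1) (n + 2) (by omega) (by omega) b1 b2 (by omega)
  have c5 := (hr n a1 a2).1 le_rfl
  have c6 := (hr (n + 2) b1 b2).2.2 le_rfl
  simp only [twistedStep, if_true] at c3 c4
  push_cast at *
  omega

theorem TwistedRun.commStep {n : ℕ} {τ : ℕ → ℤ} {w w' : List ℕ} (h : TwistedRun n τ w)
    (hs : CommStep w w') : TwistedRun n τ w' := by
  obtain ⟨u, v, i, j, hij, rfl, rfl⟩ := hs
  have hrun := h.run
  rw [isRun_append, isRun_append] at hrun
  obtain ⟨⟨r1, r2⟩, r3⟩ := hrun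
  obtain ⟨r4, r5, -⟩ := r2
  have hv := h.valid.final (twistedStep_pos n) r1
  have hres := h.residues.final u
  have hfin : final (twistedStep n) τ (u ++ [j, i]) = final (twistedStep n) τ (u ++ [i, j]) := by
    ext k
    rw [final_eq_count, final_eq_count, List.count_append, List.count_append,
      (List.Perm.swap i j []).count_eq k]
  refine ⟨?_, h.valid, h.residues, ?_, h.reduced.commStep hij, ?_⟩
  · rw [isRun_append, isRun_append, hfin]
    exact ⟨⟨r1, r5.ne_adjacent hij, r4.bump hij.symm, trivial⟩, r3⟩
  · intro a h1 h2
    rw [← h.symm a h1 h2, final_append (u ++ [j, i]), hfin, ← final_append]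
  · have hp := h.reduced_proj
    rw [projWord_append, projWord_append] at hp ⊢
    rcases projWord_pair_swap r4.1 r5.1 hij (hv.not_both_ready hres r4 (r5.ne_adjacent hij)) with e | ⟨a, b, hab, e1, e2⟩
    · rwa [← e]
    · rw [e1] at hp; rw [e2]
      exact hp.commStep hab

/-- The final state is the initial one transported by `i ↦ i^∨` and delayed by `4n + 2`, so `i^∨` is
ready at the end precisely because `i` was ready at the start. The window of times moves by one
letter. -/
theorem TwistedRun.rotate_left {n : ℕ} {τ : ℕ → ℤ} {u : List ℕ} {i : ℕ}
    (h : TwistedRun n τ ([i] ++ u)) : TwistedRun n (bump (twistedStep n) τ i) (u ++ [vee n i]) := by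
  have hr : Ready (2 * n + 1) τ i := h.run.1
  have hi : i ≤ 2 * n + 1 := hr.2.1
  have hs : ∀ j, 1 ≤ j → j ≤ 2 * n + 1 →
      final (twistedStep n) (TwistedAR.bump (twistedStep n) τ i) u j =
        τ (vee n j) + (4 * n + 2) := by
    intro j h1 h2
    have := h.symm (vee n j) (by simp only [vee]; omega) (by simp only [vee]; omega)
    rwa [vee_vee h2] at this
  refine ⟨?_, h.valid.bump (twistedStep_pos n) hr, h.residues.bump i, ?_, ?_, ?_⟩
  · rw [isRun_append]
    refine ⟨h.run.2, ⟨?_, ?_, ?_⟩, trivial⟩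
    · simp only [vee]; omega
    · have := hr.1; simp only [vee]; omega
    · intro j h1 h2 h3
      rw [hs j h1 h2, hs (vee n i) (by simp only [vee]; omega)
        (by have := hr.1; simp only [vee]; omega), vee_vee hi]
      have := hr.2.2 (vee n j) (by simp only [vee]; omega) (by simp only [vee]; omega)
        (by simp only [vee] at *; omega)
      omega
  · intro j h1 h2
    rw [final_append]
    simp only [final]
    have hj : 1 ≤ vee n j ∧ vee n j ≤ 2 * n + 1 := by simp only [vee]; omega
    rcases eq_or_ne j i with rfl | hji
    · rw [bump_self, bump_self, hs _ hj.1 hj.2, vee_vee h2, twistedStep_vee h2]; ring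
    · have : vee n j ≠ vee n i := by simp only [vee]; omega
      rw [bump_ne hji, bump_ne this, hs _ hj.1 hj.2, vee_vee h2]
  · exact h.reduced.rotate_left (by simp only [vee])
  · have hp := h.reduced_proj
    rw [projWord_append] at hp ⊢
    rcases projWord_vee hr.1 hi with ⟨e1, e2⟩ | ⟨a, e1, e2⟩
    · rw [e1] at hp; rw [e2]; simpa using hp
    · rw [e1] at hp; rw [e2]; exact hp.rotate_left rfl

/-- The clock of `i^∨` is set back by one period. That it is ready there is the validity of the old
state; validity of the new state is transported from the state before the last letter. -/
theorem TwistedRun.rotate_right {n : ℕ} {τ : ℕ → ℤ} {u : List ℕ} {i : ℕ}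
    (h : TwistedRun n τ (u ++ [i])) :
    TwistedRun n (Function.update τ (vee n i) (τ (vee n i) - twistedStep n i))
      ([vee n i] ++ u) := by
  have hrun := (isRun_append _ _).mp h.run
  have hr : Ready (2 * n + 1) (final (twistedStep n) τ u) i := hrun.2.1
  have hi : i ≤ 2 * n + 1 := hr.2.1
  have hi' : 1 ≤ vee n i ∧ vee n i ≤ 2 * n + 1 := by
    have := hr.1; simp only [vee]; omega
  have hst : twistedStep n (vee n i) = twistedStep n i := twistedStep_vee hi
  set σ := Function.update τ (vee n i) (τ (vee n i) - twistedStep n i) with hσ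
  have σs : σ (vee n i) = τ (vee n i) - twistedStep n i := by simp [hσ]
  have σn : ∀ j, j ≠ vee n i → σ j = τ j := fun j hj => by simp [hσ, hj]
  have hb : TwistedAR.bump (twistedStep n) σ (vee n i) = τ := by
    ext j
    rcases eq_or_ne j (vee n i) with rfl | hj
    · rw [bump_self, σs, hst]; ring
    · rw [bump_ne hj, σn j hj]
  have hs : ∀ j, 1 ≤ j → j ≤ 2 * n + 1 →
      final (twistedStep n) τ u (vee n j) = σ j + (4 * n + 2) := by
    intro j h1 h2
    have := h.symm j h1 h2
    rw [final_append] at this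
    simp only [TwistedAR.final] at this
    rcases eq_or_ne j (vee n i) with rfl | hj
    · rw [vee_vee hi] at this ⊢
      rw [bump_self] at this
      rw [σs]; omega
    · rw [bump_ne] at this
      · rw [σn j hj]; exact this
      · simp only [vee] at *; omega
  have hv := h.valid.final (twistedStep_pos n) hrun.1
  refine ⟨⟨⟨hi'.1, hi'.2, ?_⟩, ?_⟩, ?_, ?_, ?_, ?_, ?_⟩
  · intro j h1 h2 h3
    rw [σs, σn j (by omega), ← hst]
    exact h.valid _ _ hi'.1 hi'.2 h1 h2 h3
  · rw [hb]; exact hrun.1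
  · intro a b ha ha' hbb hb' hab
    have := hv (vee n a) (vee n b) (by simp only [vee]; omega) (by simp only [vee]; omega)
      (by simp only [vee]; omega) (by simp only [vee]; omega) (by simp only [vee]; omega)
    rw [hs a ha ha', hs b hbb hb', twistedStep_vee ha'] at this
    omega
  · refine h.residues.add fun j => ?_
    rcases eq_or_ne j (vee n i) with rfl | hj
    · exact ⟨-1, by rw [σs, hst]; ring⟩
    · exact ⟨0, by rw [σn j hj]; ring⟩
  · intro j h1 h2
    rw [← hs j h1 h2, final_append]
    simp only [TwistedAR.final, hb]
  · exact h.reduced.rotate_right (by simp only [vee])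
  · have hp := h.reduced_proj
    rw [projWord_append] at hp ⊢
    rcases projWord_vee hr.1 hi with ⟨e1, e2⟩ | ⟨a, e1, e2⟩
    · rw [e1] at hp; rw [e2]; simpa using hp
    · rw [e1] at hp; rw [e2]; exact hp.rotate_right rfl

/-! ### The base word -/

theorem vee_iterate {n i : ℕ} (h : i ≤ 2 * n + 1) (k : ℕ) :
    (vee n)^[k] i = if Even k then i else vee n i := by
  induction k with
  | zero => simp
  | succ k ih =>
    rw [Function.iterate_succ_apply', ih]
    by_cases hk : Even k
    · simp [hk, Nat.even_add_one]
    · simp [hk, Nat.even_add_one, vee_vee h]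

theorem map_vee_iterate (n k : ℕ) :
    (List.range' 1 (n + 1)).map ((vee n)^[k]) = block (n + (n + 1)) (n + 1) k := by
  rw [block]
  split_ifs with hk
  · conv_rhs => rw [← List.map_id (List.range' 1 (n + 1))]
    refine List.map_congr_left fun i hi => ?_
    rw [List.mem_range'_1] at hi
    rw [vee_iterate (by omega)]; simp [hk]
  · refine List.map_congr_left fun i hi => ?_
    rw [List.mem_range'_1] at hi
    rw [vee_iterate (by omega)]; simp [hk, vee]; omega

theorem baseWord_eq_blocks (n : ℕ) :
    baseWord n = (List.range (2 * n + 1)).flatMap (block (n + (n + 1)) (n + 1)) := by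
  simp only [baseWord, map_vee_iterate]

theorem projWord_range' {n m : ℕ} (h : m ≤ n) :
    projWord n (List.range' 1 m) = List.range' 1 m := by
  induction m with
  | zero => simp [projWord]
  | succ m ih =>
    rw [List.range'_concat, projWord_append, ih (by omega), projWord_singleton, if_pos (by omega)]

theorem projWord_range'_reverse {n m : ℕ} (h : m ≤ n) :
    projWord n ((List.range' 1 m).map (fun i => n + (n + 1) + 1 - i)) =
      (List.range' 1 m).map (fun i => n + n + 1 - i) := by
  induction m with
  | zero => simp [projWord]
  | succ m ih =>
    rw [List.range'_concat, List.map_append, projWord_append, ih (by omega), List.map_append,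
      List.map_singleton, projWord_singleton, if_neg (by omega), if_neg (by omega)]
    simp; omega

theorem projWord_block (n k : ℕ) :
    projWord n (block (n + (n + 1)) (n + 1) k) = block (n + n) n k := by
  rw [block, block]
  split_ifs
  · rw [List.range'_concat, projWord_append, projWord_range' le_rfl, projWord_singleton,
      if_neg (by omega), if_pos (by omega), List.append_nil]
  · rw [List.range'_concat, List.map_append, projWord_append, projWord_range'_reverse le_rfl,
      List.map_singleton, projWord_singleton, if_neg (by omega), if_pos (by omega),
      List.append_nil]

theorem projWord_baseWord (n : ℕ) :
    projWord n (baseWord n) = (List.range (2 * n + 1)).flatMap (block (n + n) n) := by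
  rw [baseWord_eq_blocks, projWord, List.flatMap_assoc]
  exact List.flatMap_congr fun k _ => projWord_block n k

/-- The state before the `k`-th block of the base word is read. -/
def baseState (n k : ℕ) : ℕ → ℤ := fun i =>
  if i ≤ 2 * n + 1 then
    if i = n + 1 then 2 * k + 2 * n + 1
    else if i ≤ n then (if k % 2 = 0 then 2 * k + 2 * i else 2 * k + 2 * i + 2)
    else (if k % 2 = 0 then 2 * k + 2 * vee n i + 2 else 2 * k + 2 * vee n i)
  else 0

/-- The prefixes of a block are followed letter by letter: after `t` letters exactly the first `t`
letters of the block have advanced by one period. -/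
theorem baseState_block (n k t : ℕ) (ht : t ≤ n + 1) :
    IsRun (2 * n + 1) (twistedStep n) (baseState n k)
      ((List.range' 1 t).map ((vee n)^[k])) ∧
    ∀ j, 1 ≤ j → j ≤ 2 * n + 1 →
      final (twistedStep n) (baseState n k) ((List.range' 1 t).map ((vee n)^[k])) j =
        if (if k % 2 = 0 then j else vee n j) ≤ t then baseState n k j + twistedStep n j
        else baseState n k j := by
  induction t with
  | zero =>
    refine ⟨by simp [IsRun], fun j h1 h2 => ?_⟩
    rw [if_neg]
    · rfl
    · simp only [vee]; split_ifs <;> omega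
  | succ t ih =>
    obtain ⟨ih1, ih2⟩ := ih (by omega)
    have hv : (vee n)^[k] (1 + 1 * t) = if k % 2 = 0 then t + 1 else 2 * n + 1 - t := by
      rw [vee_iterate (by omega)]
      simp only [Nat.even_iff, vee]
      split_ifs <;> omega
    rw [List.range'_concat, List.map_append, List.map_singleton, isRun_append, hv]
    set a := if k % 2 = 0 then t + 1 else 2 * n + 1 - t with ha
    refine ⟨⟨ih1, ⟨?_, ?_, fun j h1 h2 h3 => ?_⟩, trivial⟩, fun j h1 h2 => ?_⟩
    · rw [ha]; split_ifs <;> omega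
    · rw [ha]; split_ifs <;> omega
    · rw [ih2 j h1 h2, ih2 a (by rw [ha]; split_ifs <;> omega) (by rw [ha]; split_ifs <;> omega)]
      rcases Nat.mod_two_eq_zero_or_one k with hk | hk
      · simp only [hk, if_true] at ha
        simp only [hk, if_true, twistedStep, baseState, vee]
        split_ifs <;> omega
      · simp only [hk, one_ne_zero, if_false] at ha
        simp only [hk, one_ne_zero, if_false, twistedStep, baseState, vee]
        split_ifs <;> omega
    · rw [final_append]
      simp only [final]
      rcases eq_or_ne j a with rfl | hj
      · rw [bump_self, ih2 _ h1 h2, if_neg, if_pos]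
        · simp only [ha, vee]; split_ifs <;> omega
        · simp only [ha, vee]; split_ifs <;> omega
      · rw [bump_ne hj, ih2 _ h1 h2]
        congr 1
        simp only [eq_iff_iff]
        simp only [ha, vee] at hj ⊢
        split_ifs at hj ⊢ <;> omega

theorem final_baseState_block (n k j : ℕ) (h1 : 1 ≤ j) (h2 : j ≤ 2 * n + 1) :
    final (twistedStep n) (baseState n k) ((List.range' 1 (n + 1)).map ((vee n)^[k])) j =
      baseState n (k + 1) j := by
  rw [(baseState_block n k (n + 1) le_rfl).2 j h1 h2]
  rcases Nat.mod_two_eq_zero_or_one k with hk | hk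
  · have : (k + 1) % 2 ≠ 0 := by omega
    simp only [hk, if_true, twistedStep, baseState, vee, this, if_false]
    push_cast
    split_ifs <;> omega
  · have : (k + 1) % 2 = 0 := by omega
    simp only [hk, one_ne_zero, if_false, twistedStep, baseState, vee, this, if_true]
    push_cast
    split_ifs <;> omega

theorem baseState_run (n k : ℕ) :
    IsRun (2 * n + 1) (twistedStep n) (baseState n 0)
      ((List.range k).flatMap (fun k => (List.range' 1 (n + 1)).map ((vee n)^[k]))) ∧
    ∀ j, 1 ≤ j → j ≤ 2 * n + 1 → final (twistedStep n) (baseState n 0)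
      ((List.range k).flatMap (fun k => (List.range' 1 (n + 1)).map ((vee n)^[k]))) j =
        baseState n k j := by
  induction k with
  | zero => simp [IsRun, final]
  | succ k ih =>
    rw [List.range_succ, List.flatMap_append, List.flatMap_singleton, isRun_append]
    refine ⟨⟨ih.1, ?_⟩, fun j h1 h2 => ?_⟩
    · exact (baseState_block n k (n + 1) le_rfl).1.shift (d := 0)
        fun j h1 h2 => by rw [ih.2 j h1 h2]; ring
    · have e := ih.2 j h1 h2
      rw [← final_baseState_block n k j h1 h2, final_append, final_eq_count, e, ← final_eq_count]

theorem twistedRun_baseWord (n : ℕ) : TwistedRun n (baseState n 0) (baseWord n) := by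
  refine ⟨(baseState_run n (2 * n + 1)).1, ?_, ?_, ?_, ?_, ?_⟩
  · intro i j h1 h2 h3 h4 h5
    simp only [baseState, twistedStep, vee, Nat.zero_mod, if_true]
    push_cast
    split_ifs <;> omega
  · intro i h1 h2
    simp only [baseState, vee, Nat.zero_mod, if_true]
    split_ifs <;> omega
  · intro i h1 h2
    have := (baseState_run n (2 * n + 1)).2 (vee n i) (by simp only [vee]; omega)
      (by simp only [vee]; omega)
    rw [baseWord, this]
    have hm : (2 * n + 1) % 2 ≠ 0 := by omega
    simp only [baseState, vee, Nat.zero_mod, if_true, hm, if_false]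
    push_cast
    split_ifs <;> omega
  · rw [baseWord_eq_blocks]
    have := isReducedLongest_blocks (n := n) (m := n + 1) (by omega) (by omega)
    rwa [show n + (n + 1) = 2 * n + 1 by ring] at this ⊢
  · rw [projWord_baseWord]
    have := isReducedLongest_blocks (n := n) (m := n) (by omega) (by omega)
    rwa [show n + n = 2 * n by ring] at this ⊢

theorem IsTwistedAdapted.exists_twistedRun {n : ℕ} {w : List ℕ} (h : IsTwistedAdapted n w) :
    ∃ τ, TwistedRun n τ w := by
  induction h with
  | refl => exact ⟨_, twistedRun_baseWord n⟩
  | tail _ hs ih =>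
    obtain ⟨τ, hτ⟩ := ih
    rcases hs with hs | ⟨u, i, ⟨rfl, rfl⟩ | ⟨rfl, rfl⟩⟩
    · exact ⟨τ, hτ.commStep hs⟩
    · exact ⟨_, hτ.rotate_left⟩
    · exact ⟨_, hτ.rotate_right⟩

/-! ### Positions in a run -/

/-- Occurrences are numbered from `0`: the one with number `r` lies where the count passes from `r`
to `r + 1`. -/
theorem exists_occurrence (w : List ℕ) (i r k k' : ℕ) (h1 : (w.take k).count i ≤ r)
    (h2 : r < (w.take k').count i) :
    ∃ l, k ≤ l ∧ l < k' ∧ w[l]? = some i ∧ (w.take l).count i = r := by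
  induction k' with
  | zero => simp at h2
  | succ k' ih =>
    by_cases h : r < (w.take k').count i
    · obtain ⟨l, a, b, c⟩ := ih h
      exact ⟨l, a, by omega, c⟩
    · have hk : k ≤ k' := by
        by_contra hlt
        have := ((List.take_prefix_take_left (l := w) (show k' + 1 ≤ k by omega)).sublist).count_le i
        omega
      rw [List.take_add_one, List.count_append] at h2
      rcases hw : w[k']? with _ | a
      · rw [hw] at h2; simp at h2; omega
      · rw [hw] at h2
        rcases eq_or_ne a i with rfl | hai
        · refine ⟨k', hk, by omega, hw, ?_⟩
          simp at h2; omega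
        · simp [hai] at h2; omega

theorem take_succ_eq {w : List ℕ} {k i : ℕ} (h : w[k]? = some i) :
    w.take (k + 1) = w.take k ++ [i] := by
  rw [List.take_add_one, h]; rfl

section

variable {m : ℕ} {st η : ℕ → ℤ} {w : List ℕ}

theorem IsRun.take (h : IsRun m st η w) (k : ℕ) : IsRun m st η (w.take k) := by
  rw [← List.take_append_drop k w, isRun_append] at h
  exact h.1

theorem IsRun.take_append (h : IsRun m st η w) {k i : ℕ} (hk : w[k]? = some i) :
    IsRun m st η (w.take k ++ [i]) := by
  rw [← take_succ_eq hk]; exact h.take _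

theorem IsRun.ready (h : IsRun m st η w) {k i : ℕ} (hk : w[k]? = some i) :
    Ready m (final st η (w.take k)) i :=
  ((isRun_append _ _).mp (h.take_append hk)).2.1

end

/-! ### Adapted words as runs -/

/-- The times of adjacent letters differ by `2`. -/
def Alternating (m : ℕ) (η : ℕ → ℤ) : Prop :=
  ∀ i, 1 ≤ i → i + 1 ≤ m → η (i + 1) = η i + 2 ∨ η (i + 1) = η i - 2

/-- The constant period `4` of the letters in the AR-quiver of a Dynkin quiver. -/
def plainStep : ℕ → ℤ := fun _ => 4

theorem plainStep_pos (i : ℕ) : 0 < plainStep i := by simp [plainStep]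

variable {m : ℕ} {η : ℕ → ℤ}

theorem Alternating.adj (h : Alternating m η) {i j : ℕ} (hi : 1 ≤ i) (hi' : i ≤ m) (hj : 1 ≤ j)
    (hj' : j ≤ m) (hij : i = j + 1 ∨ j = i + 1) : η j = η i + 2 ∨ η j = η i - 2 := by
  rcases hij with rfl | rfl
  · have := h j hj hi'; omega
  · exact h i hi hj'

theorem Alternating.valid (h : Alternating m η) : Valid m plainStep η := by
  intro i j h1 h2 h3 h4 h5
  have := h.adj h1 h2 h3 h4 h5
  simp only [plainStep]; omega

theorem Alternating.bump (h : Alternating m η) {i : ℕ} (hi : Ready m η i) :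
    Alternating m (bump plainStep η i) := by
  intro j h1 h2
  have h3 := h j h1 h2
  rcases eq_or_ne j i with rfl | hj
  · have := hi.2.2 (j + 1) (by omega) h2 (by omega)
    rw [bump_self, bump_ne (by omega), plainStep]; omega
  · rw [bump_ne hj]
    rcases eq_or_ne (j + 1) i with rfl | hj'
    · have := hi.2.2 j h1 (by omega) (by omega)
      rw [bump_self, plainStep]; omega
    · rwa [bump_ne hj']

theorem Alternating.abs_sub_le (h : Alternating m η) {i j : ℕ} (hi : 1 ≤ i) (hij : i ≤ j)
    (hj : j ≤ m) : η j ≤ η i + 2 * (j - i) ∧ η i ≤ η j + 2 * (j - i) := by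
  induction j, hij using Nat.le_induction with
  | base => simp
  | succ j hij ih =>
    have h1 := ih (by omega)
    have h2 := h j (by omega) hj
    push_cast
    omega

/-- The arrows of `Q` point to the letters that are read first. -/
def Compatible (Q : DynkinQuiver m) (η : ℕ → ℤ) : Prop :=
  ∀ i j, 1 ≤ i → i ≤ m → 1 ≤ j → j ≤ m → (i = j + 1 ∨ j = i + 1) → (Q.Arrow i j ↔ η j < η i)

theorem Compatible.isSink_iff {Q : DynkinQuiver m} (hQ : Compatible Q η) (ha : Alternating m η)
    (i : ℕ) : Q.IsSink i ↔ Ready m η i := by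
  constructor
  · rintro ⟨h1, h2, h3⟩
    refine ⟨h1, h2, fun j hj hj' hij => ?_⟩
    have := ha.adj h1 h2 hj hj' hij
    have := mt (hQ i j h1 h2 hj hj' hij).mpr (h3 j)
    omega
  · rintro ⟨h1, h2, h3⟩
    refine ⟨h1, h2, fun j hj => ?_⟩
    obtain ⟨-, h4, h5⟩ := Q.adj _ _ hj
    have := h3 j h4.1 h4.2 h5.symm
    have := (hQ i j h1 h2 h4.1 h4.2 h5.symm).mp hj
    omega

theorem Compatible.reflect {Q : DynkinQuiver m} (hQ : Compatible Q η) (ha : Alternating m η)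
    {i : ℕ} (hi : Ready m η i) : Compatible (Q.reflect i) (bump plainStep η i) := by
  intro a b h1 h2 h3 h4 h5
  have hab := ha.adj h1 h2 h3 h4 h5
  simp only [DynkinQuiver.reflect]
  rw [hQ a b h1 h2 h3 h4 h5, hQ b a h3 h4 h1 h2 h5.symm]
  rcases eq_or_ne a i with rfl | hai
  · have := hi.2.2 b h3 h4 h5
    rw [bump_self, bump_ne (by omega), plainStep]
    simp only [true_or, true_and, not_true_eq_false, false_and, or_false]
    omega
  · rcases eq_or_ne b i with rfl | hbi
    · have := hi.2.2 a h1 h2 h5.symm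
      rw [bump_self, bump_ne hai, plainStep]
      simp only [or_true, true_and, not_true_eq_false, false_and, or_false]
      omega
    · rw [bump_ne hai, bump_ne hbi]
      simp [hai, hbi]

theorem Compatible.adapted_iff {Q : DynkinQuiver m} (hQ : Compatible Q η) (ha : Alternating m η)
    (u : List ℕ) : Q.Adapted u ↔ IsRun m plainStep η u := by
  induction u generalizing Q η with
  | nil => simp [DynkinQuiver.Adapted, IsRun]
  | cons i u ih =>
    simp only [DynkinQuiver.Adapted, IsRun, hQ.isSink_iff ha]
    exact and_congr_right fun h => ih (hQ.reflect ha h) (ha.bump h)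

/-- Whichever of `a`, `a+1` is read first is at that moment both a sink and ahead in time of the
other; earlier letters affect neither the arrow between them nor their times. -/
theorem arrow_of_adapted {Q : DynkinQuiver m} {a : ℕ} (h1 : 1 ≤ a) (h2 : a + 1 ≤ m) {u : List ℕ}
    (hQ : Q.Adapted u) (hu : IsRun m plainStep η u) (hmem : a ∈ u) :
    (Q.Arrow a (a + 1) ∧ η (a + 1) < η a) ∨ (Q.Arrow (a + 1) a ∧ η a < η (a + 1)) := by
  induction u generalizing Q η with
  | nil => simp at hmem
  | cons i u ih =>
    have hx := (Q.oriented a h1 h2).or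
    rcases eq_or_ne i a with rfl | hia
    · exact Or.inr ⟨hx.resolve_left (hQ.1.2.2 _), hu.1.2.2 _ (by omega) h2 (by omega)⟩
    · rcases eq_or_ne i (a + 1) with rfl | hia'
      · exact Or.inl ⟨hx.resolve_right (hQ.1.2.2 _), hu.1.2.2 _ h1 (by omega) (by omega)⟩
      · have hm : a ∈ u := by
          rcases List.mem_cons.mp hmem with h | h
          · exact absurd h.symm hia
          · exact h
        have := ih hQ.2 hu.2 hm
        rw [bump_ne hia.symm, bump_ne hia'.symm] at this
        simpa [DynkinQuiver.reflect, hia.symm, hia'.symm] using this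

/-- The word `w` is a reduced word of the longest element which is adapted to `Q` and is read from
the state `η`; the time `t` corresponds to the height `(K - t) / 2`. -/
structure AdaptedRun (m : ℕ) (η : ℕ → ℤ) (Q : DynkinQuiver m) (ξ : ℕ → ℤ) (K : ℤ) (w : List ℕ) :
    Prop where
  run : IsRun m plainStep η w
  alt : Alternating m η
  reduced : IsReducedLongest m w
  symm : ∀ i, 1 ≤ i → i ≤ m → final plainStep η w (m + 1 - i) = η i + (2 * m + 2)
  compat : Compatible Q η
  height : ∀ i, 1 ≤ i → i ≤ m → 2 * ξ i + η i = K

/-- Adjacent times differ by `2`, so those of `i` and `m + 1 - i` differ by at most `2(m - 1)`. The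
delay `2m + 2` therefore cannot be reached without reading `i`. -/
theorem count_pos_of_symm {w : List ℕ} (alt : Alternating m η)
    (symm : ∀ i, 1 ≤ i → i ≤ m → final plainStep η w (m + 1 - i) = η i + (2 * m + 2))
    {i : ℕ} (h1 : 1 ≤ i) (h2 : i ≤ m) : 0 < w.count i := by
  have h := symm (m + 1 - i) (by omega) (by omega)
  rw [show m + 1 - (m + 1 - i) = i by omega, final_eq_count, plainStep] at h
  by_contra hc
  have hc : w.count i = 0 := by omega
  rw [hc] at h
  rcases le_total i (m + 1 - i) with hi | hi
  · have := alt.abs_sub_le h1 hi (by omega)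
    push_cast at *
    omega
  · have := alt.abs_sub_le (by omega) hi h2
    push_cast at *
    omega

theorem exists_adaptedRun {Q : DynkinQuiver m} {ξ : ℕ → ℤ} {w : List ℕ}
    (run : IsRun m plainStep η w) (alt : Alternating m η) (reduced : IsReducedLongest m w)
    (symm : ∀ i, 1 ≤ i → i ≤ m → final plainStep η w (m + 1 - i) = η i + (2 * m + 2))
    (hQ : Q.Adapted w) (hξ : Q.IsHeight ξ) : AdaptedRun m η Q ξ (2 * ξ 1 + η 1) w := by
  have hmem : ∀ a, 1 ≤ a → a ≤ m → a ∈ w := fun a h1 h2 =>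
    List.count_pos_iff.mp (count_pos_of_symm alt symm h1 h2)
  refine ⟨run, alt, reduced, symm, ?_, ?_⟩
  · rintro i j h1 h2 h3 h4 (rfl | rfl)
    · have hx := (xor_iff_or_and_not_and _ _).mp (Q.oriented j h3 h2)
      rcases arrow_of_adapted h3 h2 hQ run (hmem _ h3 h4) with h | h
      · exact iff_of_false (fun h' => hx.2 ⟨h.1, h'⟩) (by omega)
      · exact iff_of_true h.1 h.2
    · have hx := (xor_iff_or_and_not_and _ _).mp (Q.oriented i h1 h4)
      rcases arrow_of_adapted h1 h4 hQ run (hmem _ h1 h2) with h | h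
      · exact iff_of_true h.1 h.2
      · exact iff_of_false (fun h' => hx.2 ⟨h', h.1⟩) (by omega)
  · intro i h1
    induction i, h1 using Nat.le_induction with
    | base => intro _; rfl
    | succ i h1 ih =>
      intro h2
      have h3 := ih (by omega)
      have h4 := alt i h1 h2
      rcases arrow_of_adapted h1 h2 hQ run (hmem _ h1 (by omega)) with h | h
      · have := hξ _ _ h.1; omega
      · have := hξ _ _ h.1; omega

/-- Reading all letters in order of time is a run: a neighbour read earlier has advanced by `4 > 2`,
and one still to come is later by exactly `2`, as adjacent times are never equal. -/
theorem isRun_of_sorted (alt : Alternating m η) (v L : List ℕ)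
    (hs : L.Pairwise fun a b => η a ≤ η b) (hp : (v ++ L).Perm (List.range' 1 m)) :
    IsRun m plainStep (final plainStep η v) L := by
  induction L generalizing v with
  | nil => trivial
  | cons a L ih =>
    have hnd : (v ++ a :: L).Nodup := hp.nodup_iff.mpr List.nodup_range'
    have hr : ∀ j, j ∈ v ++ a :: L ↔ 1 ≤ j ∧ j ≤ m := by
      intro j; rw [hp.mem_iff, List.mem_range'_1]; omega
    have ha := (hr a).mp (by simp)
    have hav : a ∉ v := fun h => by
      rw [List.nodup_append] at hnd
      exact hnd.2.2 a h a (by simp) rfl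
    constructor
    · refine ⟨ha.1, ha.2, fun j h1 h2 h3 => ?_⟩
      have hadj := alt.adj ha.1 ha.2 h1 h2 h3
      rw [final_eq_count, final_eq_count, List.count_eq_zero_of_not_mem hav]
      simp only [plainStep]
      rcases List.mem_append.mp ((hr j).mpr ⟨h1, h2⟩) with hj | hj
      · have : (1 : ℤ) ≤ v.count j := by exact_mod_cast List.count_pos_iff.mpr hj
        push_cast
        omega
      · have hj : j ∈ L := by
          rcases List.mem_cons.mp hj with h | h
          · omega
          · exact h
        have := (List.pairwise_cons.mp hs).1 j hj
        push_cast
        omega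
    · have := ih (v ++ [a]) (List.pairwise_cons.mp hs).2 (by simpa using hp)
      rwa [final_append] at this

theorem exists_coxeterWord {Q : DynkinQuiver m} (alt : Alternating m η) (hQ : Compatible Q η) :
    ∃ c, Q.IsCoxeterWord c := by
  refine ⟨(List.range' 1 m).insertionSort (fun a b => η a ≤ η b),
    List.perm_insertionSort _ _, ?_⟩
  rw [hQ.adapted_iff alt]
  refine isRun_of_sorted alt [] _ ?_ (List.perm_insertionSort _ _)
  have : Std.Total (fun a b => η a ≤ η b) := ⟨fun a b => le_total (η a) (η b)⟩
  have : IsTrans ℕ (fun a b => η a ≤ η b) := ⟨fun a b c h h' => le_trans h h'⟩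
  exact List.pairwise_insertionSort _ _

theorem final_coxeterWord {Q : DynkinQuiver m} {c : List ℕ} (hc : Q.IsCoxeterWord c) {j : ℕ}
    (h1 : 1 ≤ j) (h2 : j ≤ m) : final plainStep η c j = η j + 4 := by
  rw [final_eq_count, hc.1.count_eq, List.count_eq_one_of_mem List.nodup_range', plainStep]
  · norm_num
  · rw [List.mem_range'_1]; omega

/-! ### The translate of a run by the diagram automorphism -/

theorem isRun_map_star {η' : ℕ → ℤ} {d : ℤ}
    (h : ∀ j, 1 ≤ j → j ≤ m → η' (m + 1 - j) = η j + d) {u : List ℕ}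
    (hu : IsRun m plainStep η u) : IsRun m plainStep η' (u.map fun i => m + 1 - i) := by
  induction u generalizing η η' with
  | nil => trivial
  | cons i u ih =>
    have hi := hu.1
    have h1 := hi.1
    have h2 := hi.2.1
    refine ⟨⟨by dsimp only; omega, by dsimp only; omega, fun j hj hj' hij => ?_⟩, ih (fun j hj hj' => ?_) hu.2⟩
    · have e := h (m + 1 - j) (by omega) (by omega)
      rw [show m + 1 - (m + 1 - j) = j by omega] at e
      have := hi.2.2 (m + 1 - j) (by omega) (by omega) (by dsimp only at hij; omega)
      rw [e, h i h1 h2]; omega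
    · rcases eq_or_ne j i with rfl | hji
      · rw [bump_self, bump_self, h j hj hj', plainStep, plainStep]; ring
      · rw [bump_ne hji, bump_ne (by dsimp only; omega), h j hj hj']

theorem weyl_map_star {u : List ℕ} (hu : ∀ i ∈ u, 1 ≤ i ∧ i ≤ m) {y : ℕ} (h1 : 1 ≤ y)
    (h2 : y ≤ m + 1) :
    weyl (u.map fun i => m + 1 - i) y = m + 2 - weyl u (m + 2 - y) := by
  induction u with
  | nil => simp [weyl]; omega
  | cons i u ih =>
    have hi := hu i List.mem_cons_self
    have hu' : ∀ i ∈ u, 1 ≤ i ∧ i ≤ m := fun j hj => hu j (List.mem_cons_of_mem _ hj)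
    have e1 : weyl ((i :: u).map fun i => m + 1 - i) y = Equiv.swap (m + 1 - i) (m + 1 - i + 1)
        (weyl (u.map fun i => m + 1 - i) y) := by simp [weyl]
    have e2 : weyl (i :: u) (m + 2 - y) = Equiv.swap i (i + 1) (weyl u (m + 2 - y)) := by
      simp [weyl]
    have := weyl_mapsTo hu' (x := m + 2 - y) (by omega) (by omega)
    rw [e1, e2, ih hu', Equiv.swap_apply_def, Equiv.swap_apply_def]
    split_ifs <;> omega

variable {Q : DynkinQuiver m} {ξ : ℕ → ℤ} {K : ℤ} {w : List ℕ}

/-- Beyond the end of the word, the next label of every letter is a negative root. -/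
theorem AdaptedRun.next_label_notMem (h : AdaptedRun m η Q ξ K w) {u : List ℕ} {i : ℕ}
    (hu : IsRun m plainStep η (u ++ [i]))
    (he : final plainStep η u i = final plainStep η w i) :
    act (weyl u) (simpleRoot i) ∉ posRoots m := by
  have hi := hu.mem_range (i := i) (by simp)
  have hc := count_pos_of_symm h.alt h.symm (i := m + 1 - i) (by omega) (by omega)
  -- The run `w` continues by its own image under `i ↦ i^*`. If `x` precedes the first `i^*` in `w`,
  -- then `w x^* i` reads `i` at its first time after `w`, and its label `w₀ x^*(α_i)` is the
  -- negative of the label `x(α_{i^*})`.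
  obtain ⟨k, -, -, hk, hk0⟩ := exists_occurrence w (m + 1 - i) 0 0 w.length (by simp)
    (by simpa using hc)
  set x := w.take k with hx
  have hxr : ∀ j ∈ x, 1 ≤ j ∧ j ≤ m := fun j hj => h.reduced.mem_range j (List.mem_of_mem_take hj)
  have hrun : IsRun m plainStep η (w ++ x.map (fun i => m + 1 - i) ++ [i]) := by
    have h1 := isRun_map_star h.symm (h.run.take_append hk)
    rw [List.map_append, List.map_singleton, show m + 1 - (m + 1 - i) = i by omega] at h1
    rw [List.append_assoc, isRun_append]
    exact ⟨h.run, h1⟩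
  have hnot : (x.map (fun i => m + 1 - i)).count i = 0 := by
    refine List.count_eq_zero_of_not_mem fun hmem => ?_
    obtain ⟨j, hj, hji⟩ := List.mem_map.mp hmem
    have := hxr j hj
    have hj' : m + 1 - i = j := by omega
    rw [hj'] at hk0
    exact List.count_eq_zero.mp hk0 hj
  have hlab := label_eq plainStep_pos h.alt.valid hu hrun (by
    rw [he, final_append, final_eq_count (η := final plainStep η w), hnot]; simp)
  rw [hlab]
  have hpos : IsLabel w k (m + 1 - i) (act (weyl x) (simpleRoot (m + 1 - i))) := ⟨hk, rfl⟩
  have hneg := neg_notMem_posRoots (h.reduced.label_mem hpos)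
  have a1 := weyl_mapsTo hxr (x := m + 2 - i) (by omega) (by omega)
  have a2 := weyl_mapsTo hxr (x := m + 2 - (i + 1)) (by omega) (by omega)
  convert hneg using 1
  rw [act_simpleRoot, act_simpleRoot, weyl_append, Equiv.Perm.mul_apply, Equiv.Perm.mul_apply,
    weyl_map_star hxr hi.1 (by omega), weyl_map_star hxr (by omega) (by omega),
    h.reduced.longest _ (by omega) (by omega), h.reduced.longest _ (by omega) (by omega)]
  rw [show m + 2 - (m + 2 - weyl x (m + 2 - i)) = weyl x (m + 2 - i) by omega,
    show m + 2 - (m + 2 - weyl x (m + 2 - (i + 1))) = weyl x (m + 2 - (i + 1)) by omega,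
    show m + 2 - (i + 1) = m + 1 - i by omega, show m + 1 - i + 1 = m + 2 - i by omega]
  rw [neg_sub]

/-- A Coxeter word advances every clock by `4`; hence applying `φ_Q` to a label is moving to the
next occurrence of its letter. -/
theorem AdaptedRun.prepend (h : AdaptedRun m η Q ξ K w) {c : List ℕ} (hc : Q.IsCoxeterWord c)
    {u : List ℕ} {i : ℕ} (hu : IsRun m plainStep η (u ++ [i])) :
    IsRun m plainStep η ((c ++ u) ++ [i]) ∧
      final plainStep η (c ++ u) i = final plainStep η u i + 4 := by
  have hi := hu.mem_range (i := i) (by simp)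
  have hc' := (h.compat.adapted_iff h.alt c).mp hc.2
  constructor
  · rw [List.append_assoc, isRun_append]
    exact ⟨hc', hu.shift fun j h1 h2 => final_coxeterWord hc h1 h2⟩
  · rw [final_append, final_eq_count, final_coxeterWord hc hi.1 hi.2, final_eq_count]
    ring

theorem AdaptedRun.exists_of_coord (h : AdaptedRun m η Q ξ K w) {γ : Lattice} {i : ℕ} {p : ℤ}
    (hp : Q.ARCoord ξ γ i p) : ∃ (r : ℕ) (u : List ℕ), p = ξ i - 2 * r ∧
      IsRun m plainStep η (u ++ [i]) ∧ final plainStep η u i = η i + 4 * r ∧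
      γ = act (weyl u) (simpleRoot i) ∧ r < w.count i := by
  induction hp with
  | base c hc k i β hl =>
    have hrun := ((h.compat.adapted_iff h.alt c).mp hc.2).take_append hl.1
    have hi := hrun.mem_range (i := i) (by simp)
    refine ⟨0, c.take k, by simp, hrun, ?_, hl.2, count_pos_of_symm h.alt h.symm hi.1 hi.2⟩
    have h1 := List.nodup_iff_count_le_one.mp (hc.1.nodup_iff.mpr List.nodup_range') i
    have h2 := ((List.take_sublist (k + 1) c).count_le i)
    rw [take_succ_eq hl.1, List.count_append] at h2
    rw [final_eq_count]
    simp at h2 ⊢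
    have : (c.take k).count i = 0 := by omega
    simp [this]
  | step c hc β i p hβ hpos ih =>
    obtain ⟨r, u, rfl, hu, hf, rfl, hr⟩ := ih
    have hp := h.prepend hc hu
    have hf' : final plainStep η (c ++ u) i = η i + 4 * (r + 1 : ℕ) := by
      rw [hp.2, hf]; push_cast; ring
    refine ⟨r + 1, c ++ u, by push_cast; ring, hp.1, hf', by rw [weyl_append, act_mul], ?_⟩
    -- Otherwise `r` was the last occurrence of `i` in `w`, and the new label would be the first one
    -- beyond the end, which is not positive.
    by_contra hcon
    refine h.next_label_notMem hp.1 ?_ (by rwa [weyl_append, act_mul])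
    rw [hf', final_eq_count, plainStep, show w.count i = r + 1 by omega]

theorem AdaptedRun.coord_of_label (h : AdaptedRun m η Q ξ K w) (r : ℕ) {k i : ℕ} {γ : Lattice}
    (hl : IsLabel w k i γ) (hr : (w.take k).count i = r) : Q.ARCoord ξ γ i (ξ i - 2 * r) := by
  obtain ⟨c, hc⟩ := exists_coxeterWord h.alt h.compat
  have hi := h.reduced.mem_range i (List.mem_of_getElem? hl.1)
  induction r generalizing k γ with
  | zero =>
    have hic : i ∈ c := by rw [hc.1.mem_iff, List.mem_range'_1]; omega
    obtain ⟨l, -, -, hl', hl0⟩ := exists_occurrence c i 0 0 c.length (by simp)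
      (by simpa using hic)
    have hcr := (h.compat.adapted_iff h.alt c).mp hc.2
    have e := label_eq plainStep_pos h.alt.valid (h.run.take_append hl.1) (hcr.take_append hl')
      (by rw [final_eq_count, final_eq_count, hr, hl0])
    rw [hl.2, e]
    simpa using DynkinQuiver.ARCoord.base c hc l i _ ⟨hl', rfl⟩
  | succ r ih =>
    obtain ⟨l, -, -, hl', hl0⟩ := exists_occurrence w i r 0 k (by simp) (by omega)
    have h1 := ih ⟨hl', rfl⟩ hl0
    have hp := h.prepend hc (h.run.take_append hl')
    have e := label_eq plainStep_pos h.alt.valid (h.run.take_append hl.1) hp.1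
      (by rw [hp.2, final_eq_count, final_eq_count, hr, hl0, plainStep]; push_cast; ring)
    rw [weyl_append, act_mul, ← hl.2] at e
    have h2 := DynkinQuiver.ARCoord.step c hc _ i _ h1 (by rw [← e]; exact h.reduced.label_mem hl)
    rw [← e] at h2
    convert h2 using 1
    push_cast; ring

theorem AdaptedRun.coord_iff (h : AdaptedRun m η Q ξ K w) {k i : ℕ} {γ : Lattice} {p : ℤ}
    (hl : IsLabel w k i γ) :
    Q.ARCoord ξ γ i p ↔ 2 * p = K - final plainStep η (w.take k) i := by
  have hi := h.reduced.mem_range i (List.mem_of_getElem? hl.1)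
  have hK := h.height i hi.1 hi.2
  constructor
  · intro hp
    obtain ⟨r, u, rfl, hu, hf, hγ, hr⟩ := h.exists_of_coord hp
    obtain ⟨l, -, -, hl', hl0⟩ := exists_occurrence w i r 0 w.length (by simp) (by simpa using hr)
    have hf' : final plainStep η (w.take l) i = η i + 4 * r := by
      rw [final_eq_count, hl0, plainStep]
    have e := label_eq plainStep_pos h.alt.valid hu (h.run.take_append hl') (by rw [hf, hf'])
    obtain ⟨rfl, -⟩ := h.reduced.label_injective hl ⟨hl', hγ.trans e⟩
    rw [hf']; omega
  · intro hp
    have := h.coord_of_label _ hl rfl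
    convert this using 1
    rw [final_eq_count, plainStep] at hp
    omega

/-! ### Times of positions -/

/-- The position `k` of `w` carries the letter `i`, which is read there at time `T`. -/
def At (st η : ℕ → ℤ) (w : List ℕ) (k i : ℕ) (T : ℤ) : Prop :=
  w[k]? = some i ∧ final st η (w.take k) i = T

section

variable {m : ℕ} {st η : ℕ → ℤ} {w : List ℕ}

theorem count_take_mono {k l : ℕ} (h : k ≤ l) (i : ℕ) :
    (w.take k).count i ≤ (w.take l).count i :=
  ((List.take_prefix_take_left h).sublist).count_le i

theorem final_take_mono (hst : ∀ i, 0 < st i) {k l : ℕ} (h : k ≤ l) (i : ℕ) :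
    final st η (w.take k) i ≤ final st η (w.take l) i := by
  rw [final_eq_count, final_eq_count]
  have : ((w.take k).count i : ℤ) ≤ (w.take l).count i := by exact_mod_cast count_take_mono h i
  nlinarith [hst i]

theorem At.final_succ {k i : ℕ} {T : ℤ} (h : At st η w k i T) :
    final st η (w.take (k + 1)) i = T + st i := by
  rw [take_succ_eq h.1, final_append]
  simp only [final, bump_self, h.2]

theorem At.final_succ_ne {k i j : ℕ} {T : ℤ} (h : At st η w k i T) (hj : j ≠ i) :
    final st η (w.take (k + 1)) j = final st η (w.take k) j := by
  rw [take_succ_eq h.1, final_append]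
  simp only [final, bump_ne hj]

theorem At.add_le (hst : ∀ i, 0 < st i) {k l i : ℕ} {S T : ℤ} (h : At st η w k i S)
    (h' : At st η w l i T) (hkl : k < l) : S + st i ≤ T := by
  rw [← h.final_succ, ← h'.2]
  exact final_take_mono hst hkl i

theorem At.unique (hst : ∀ i, 0 < st i) {k l i : ℕ} {T : ℤ} (h : At st η w k i T)
    (h' : At st η w l i T) : k = l := by
  have := hst i
  rcases lt_trichotomy k l with hkl | hkl | hkl
  · have := h.add_le hst h' hkl; omega
  · exact hkl
  · have := h'.add_le hst h hkl; omega

theorem At.lt_of_adj (hst : ∀ i, 0 < st i) (hw : IsRun m st η w) {k l i j : ℕ} {S T : ℤ}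
    (h : At st η w k i S) (h' : At st η w l j T) (hij : i = j + 1 ∨ j = i + 1) (hST : S < T) :
    k < l := by
  by_contra hlt
  have hi := (hw.ready h.1)
  have := (hw.ready h'.1).2.2 i hi.1 hi.2.1 hij.symm
  have := final_take_mono (η := η) (w := w) hst (not_lt.mp hlt) i
  rw [h.2] at this
  rw [h'.2] at *
  omega

/-- At `k` the previous reading of `j` was before `T`, and at `k'` the next one is after `T'`; every
admissible time of `j` strictly between is thus read between these positions. -/
theorem At.exists_between (hst : ∀ i, 0 < st i) (hv : Valid m st η) (hw : IsRun m st η w)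
    {k k' i j : ℕ} {T T' U : ℤ} (h : At st η w k i T) (h' : At st η w k' i T')
    (hj : 1 ≤ j) (hj' : j ≤ m) (hij : i = j + 1 ∨ j = i + 1) (h1 : T < U) (h2 : U < T')
    (hU : ∃ z, U = η j + st j * z) : ∃ l, At st η w l j U := by
  obtain ⟨z, rfl⟩ := hU
  have hi := hw.ready h.1
  have a := hv.final hst (hw.take k) j i hj hj' hi.1 hi.2.1 hij.symm
  have b := (hw.ready h'.1).2.2 j hj hj' hij
  rw [h.2] at a
  rw [h'.2] at b
  rw [final_eq_count] at a b
  have c := hst j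
  have hz : ((w.take k).count j : ℤ) ≤ z := by
    by_contra hc
    have : z + 1 ≤ (w.take k).count j := by omega
    nlinarith
  have hz' : z < (w.take k').count j := by
    by_contra hc
    have : ((w.take k').count j : ℤ) ≤ z := by omega
    nlinarith
  obtain ⟨r, rfl⟩ := Int.eq_ofNat_of_zero_le (a := z) (by omega)
  obtain ⟨l, -, -, hl, hl'⟩ := exists_occurrence w j r k k' (by exact_mod_cast hz)
    (by exact_mod_cast hz')
  exact ⟨l, hl, by rw [final_eq_count, hl']⟩

/-- Together with `exists_at_of_posArrow` this describes arrows by times: they go from the later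
letter to the earlier one, with less than one period of either letter between them. -/
theorem At.posArrow (hst : ∀ i, 0 < st i) (hw : IsRun m st η w) {k l a b : ℕ} {S T : ℤ}
    (h : At st η w k a S) (h' : At st η w l b T) (hab : a = b + 1 ∨ b = a + 1) (h1 : T < S)
    (h2 : S < T + st a) (h3 : S < T + st b) : PosArrow w k l := by
  have hlk := h'.lt_of_adj hst hw h hab.symm h1
  refine ⟨a, b, h.1, h'.1, hab, ⟨⟨hlk, h'.1⟩, ?_⟩, ⟨⟨hlk, h.1⟩, ?_⟩⟩
  · rintro j ⟨hj, hjb⟩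
    have hA : At st η w j b _ := ⟨hjb, rfl⟩
    by_contra hc
    have e := h'.add_le hst hA (not_le.mp hc)
    have := h.lt_of_adj hst hw hA hab (by omega)
    omega
  · rintro j ⟨hj, hja⟩
    have hA : At st η w j a _ := ⟨hja, rfl⟩
    by_contra hc
    have e := hA.add_le hst h (not_le.mp hc)
    have := hA.lt_of_adj hst hw h' hab (by omega)
    omega

theorem exists_at_of_posArrow (hst : ∀ i, 0 < st i) (hv : Valid m st η) (hw : IsRun m st η w)
    {k l : ℕ} (h : PosArrow w k l) : ∃ a b S T, At st η w k a S ∧ At st η w l b T ∧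
      (a = b + 1 ∨ b = a + 1) ∧ T < S ∧ S < T + st a ∧ S < T + st b := by
  obtain ⟨a, b, ha, hb, hab, ⟨⟨hlk, -⟩, hg⟩, ⟨-, hl⟩⟩ := h
  have A : At st η w k a _ := ⟨ha, rfl⟩
  have B : At st η w l b _ := ⟨hb, rfl⟩
  have eb : final st η (w.take k) b = final st η (w.take l) b + st b := by
    rw [← B.final_succ, final_eq_count, final_eq_count]
    by_contra hne
    have hle := count_take_mono (w := w) (show l + 1 ≤ k by omega) b
    have hlt : (w.take (l + 1)).count b < (w.take k).count b := by
      refine lt_of_le_of_ne hle fun h => hne (by rw [h])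
    obtain ⟨j, h1, h2, h3, -⟩ := exists_occurrence w b _ (l + 1) k le_rfl hlt
    have := hg ⟨h2, h3⟩
    omega
  have ea : final st η (w.take l) a = final st η (w.take k) a := by
    rw [← B.final_succ_ne (j := a) (by omega), final_eq_count, final_eq_count]
    by_contra hne
    have hle := count_take_mono (w := w) (show l + 1 ≤ k by omega) a
    have hlt : (w.take (l + 1)).count a < (w.take k).count a := by
      refine lt_of_le_of_ne hle fun h => hne (by rw [h])
    obtain ⟨j, h1, h2, h3, -⟩ := exists_occurrence w a _ (l + 1) k le_rfl hlt
    have := hl ⟨by omega, h3⟩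
    omega
  have ra := hw.ready ha
  have rb := hw.ready hb
  have c1 := ra.2.2 b rb.1 rb.2.1 hab
  have c2 := rb.2.2 a ra.1 ra.2.1 hab.symm
  have c3 := hv.final hst (hw.take l) a b ra.1 ra.2.1 rb.1 rb.2.1 hab
  exact ⟨a, b, _, _, A, B, hab, by omega, by omega, by omega⟩

end

/-! ### The projected word -/

theorem count_projWord {n i : ℕ} (hi : 1 ≤ i) {u : List ℕ} (hu : ∀ j ∈ u, 1 ≤ j) :
    (projWord n u).count i = u.count (plus n i) := by
  induction u with
  | nil => simp [projWord]
  | cons a u ih =>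
    have ha := hu a List.mem_cons_self
    have ih := ih fun j hj => hu j (List.mem_cons_of_mem _ hj)
    rw [← List.singleton_append, projWord_append, List.count_append, List.count_append, ih,
      projWord_singleton, plus]
    congr 1
    split_ifs <;> simp only [List.count_singleton, List.count_nil, beq_iff_eq] <;>
      split_ifs <;> omega

theorem final_projWord {n i : ℕ} {τ : ℕ → ℤ} (hi : 1 ≤ i) {u : List ℕ} (hu : ∀ j ∈ u, 1 ≤ j) :
    final plainStep (fun i => τ (plus n i)) (projWord n u) i =
      final (twistedStep n) τ u (plus n i) := by
  rw [final_eq_count, final_eq_count, count_projWord hi hu, plainStep, twistedStep, if_neg]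
  rw [plus]; split_ifs <;> omega

/-- The new edge joins `n` and `n+2`. Validity puts each of their times within `-1, 1, 3` of that of
the middle letter, taken as the excess over it, so they differ by at most `4`; their residues leave
only a difference of `2`. -/
theorem alternating_plus {n : ℕ} {τ : ℕ → ℤ} (hv : Valid (2 * n + 1) (twistedStep n) τ)
    (hr : Residues n τ) : Alternating (2 * n) fun i => τ (plus n i) := by
  intro i h1 h2
  simp only [plus]
  have key : ∀ a b, 1 ≤ a → a ≤ 2 * n + 1 → 1 ≤ b → b ≤ 2 * n + 1 → (a = b + 1 ∨ b = a + 1) →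
      τ a - twistedStep n a < τ b := fun a b h1 h2 h3 h4 h5 => hv a b h1 h2 h3 h4 h5
  rcases lt_trichotomy i n with h | h | h
  · rw [if_pos (by omega), if_pos (by omega)]
    have a := key i (i + 1) h1 (by omega) (by omega) (by omega) (by omega)
    have b := key (i + 1) i (by omega) (by omega) h1 (by omega) (by omega)
    have c := (hr i h1 (by omega)).1 (by omega)
    have d := (hr (i + 1) (by omega) (by omega)).1 (by omega)
    simp only [twistedStep] at a b
    push_cast at *
    split_ifs at a b <;> omega
  · subst h
    rw [if_neg (by omega), if_pos le_rfl]
    have a := key i (i + 1) h1 (by omega) (by omega) (by omega) (by omega)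
    have b := key (i + 1) i (by omega) (by omega) h1 (by omega) (by omega)
    have a' := key (i + 1) (i + 1 + 1) (by omega) (by omega) (by omega) (by omega) (by omega)
    have b' := key (i + 1 + 1) (i + 1) (by omega) (by omega) (by omega) (by omega) (by omega)
    have c := (hr i h1 (by omega)).1 (by omega)
    have d := (hr (i + 1 + 1) (by omega) (by omega)).2.2 (by omega)
    have e := (hr (i + 1) (by omega) (by omega)).2.1 (by omega)
    simp only [twistedStep] at a b a' b'
    push_cast at *
    split_ifs at a b a' b' <;> omega
  · rw [if_neg (by omega), if_neg (by omega)]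
    have a := key (i + 1) (i + 1 + 1) (by omega) (by omega) (by omega) (by omega) (by omega)
    have b := key (i + 1 + 1) (i + 1) (by omega) (by omega) (by omega) (by omega) (by omega)
    have c := (hr (i + 1) (by omega) (by omega)).2.2 (by omega)
    have d := (hr (i + 1 + 1) (by omega) (by omega)).2.2 (by omega)
    simp only [twistedStep] at a b
    push_cast at *
    split_ifs at a b <;> omega

theorem exists_plus {n j : ℕ} (h1 : 1 ≤ j) (h2 : j ≤ 2 * n + 1) (hj : j ≠ n + 1) :
    ∃ i, 1 ≤ i ∧ i ≤ 2 * n ∧ plus n i = j ∧ projWord n [j] = [i] := by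
  rw [projWord_singleton]
  by_cases h : j ≤ n
  · exact ⟨j, h1, by omega, by simp [plus, h], by simp [h]⟩
  · refine ⟨j - 1, by omega, by omega, ?_, by simp [h, hj]⟩
    rw [plus, if_neg (by omega)]; omega

/-- Only the pair `n`, `n+2` is new. The middle letter lies after the ready one and at most `1`
after the other, so the other is not earlier, and alternation makes it later by `2`. -/
theorem ready_projWord {n i : ℕ} {τ : ℕ → ℤ} (hv : Valid (2 * n + 1) (twistedStep n) τ)
    (hr : Residues n τ) (h1 : 1 ≤ i) (h2 : i ≤ 2 * n) (h : Ready (2 * n + 1) τ (plus n i)) :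
    Ready (2 * n) (fun i => τ (plus n i)) i := by
  refine ⟨h1, h2, fun j hj hj' hij => ?_⟩
  have alt := (alternating_plus hv hr).adj h1 h2 hj hj' hij
  dsimp only at alt ⊢
  by_cases hadj : plus n i = plus n j + 1 ∨ plus n j = plus n i + 1
  · refine h.2.2 _ ?_ ?_ hadj
    · rw [plus]; split_ifs <;> omega
    · rw [plus]; split_ifs <;> omega
  · have hm : plus n i = n + 1 + 1 ∧ plus n j + 1 = n + 1 ∨
        plus n i + 1 = n + 1 ∧ plus n j = n + 1 + 1 := by
      simp only [plus] at *
      split_ifs at * <;> omega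
    have a := h.2.2 (n + 1) (by omega) (by omega) (by omega)
    have b := hv (n + 1) (plus n j) (by omega) (by omega) (by omega) (by omega) (by omega)
    simp only [twistedStep, if_true] at b
    omega

theorem isRun_projWord {n : ℕ} {τ : ℕ → ℤ} (hv : Valid (2 * n + 1) (twistedStep n) τ)
    (hr : Residues n τ) {u : List ℕ} (hu : IsRun (2 * n + 1) (twistedStep n) τ u) :
    IsRun (2 * n) plainStep (fun i => τ (plus n i)) (projWord n u) := by
  induction u generalizing τ with
  | nil => simp [projWord, IsRun]
  | cons a u ih =>
    have ih := ih (hv.bump (twistedStep_pos n) hu.1) (hr.bump a) hu.2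
    rw [← List.singleton_append, projWord_append]
    by_cases ha : a = n + 1
    · rw [projWord_singleton, if_neg (by omega), if_pos ha, List.nil_append]
      convert ih using 2
      rw [bump_ne]
      rw [plus]; split_ifs <;> omega
    · obtain ⟨i, h1, h2, rfl, h3⟩ := exists_plus hu.1.1 hu.1.2.1 ha
      rw [h3]
      refine ⟨ready_projWord hv hr h1 h2 hu.1, ?_⟩
      change IsRun _ _ _ (projWord n u)
      convert ih using 1
      ext j
      rcases eq_or_ne j i with rfl | hj
      · rw [bump_self, bump_self, twistedStep, if_neg ha, plainStep]
      · rw [bump_ne hj, bump_ne]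
        simp only [plus]; split_ifs <;> omega

theorem TwistedRun.adaptedRun {n : ℕ} {τ : ℕ → ℤ} {w : List ℕ} (h : TwistedRun n τ w)
    {Q : DynkinQuiver (2 * n)} (hQ : Q.Adapted (projWord n w)) {ξ : ℕ → ℤ} (hξ : Q.IsHeight ξ) :
    ∃ K, AdaptedRun (2 * n) (fun i => τ (plus n i)) Q ξ K (projWord n w) := by
  refine ⟨_, exists_adaptedRun (isRun_projWord h.valid h.residues h.run)
    (alternating_plus h.valid h.residues) h.reduced_proj (fun i h1 h2 => ?_) hQ hξ⟩
  have hp : 1 ≤ plus n i ∧ plus n i ≤ 2 * n + 1 ∧ plus n (2 * n + 1 - i) = vee n (plus n i) := by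
    simp only [plus, vee]; split_ifs <;> omega
  rw [final_projWord (by omega) fun j hj => (h.reduced.mem_range j hj).1, hp.2.2,
    h.symm _ hp.1 hp.2.1]
  push_cast; ring

/-! ### Coordinates and times -/

/-- The data of a twisted adapted word together with the quiver and the height function that
define the coordinates. -/
structure CoordRun (n : ℕ) (τ : ℕ → ℤ) (Q : DynkinQuiver (2 * n)) (ξ : ℕ → ℤ) (K : ℤ)
    (w : List ℕ) : Prop extends TwistedRun n τ w where
  proj : AdaptedRun (2 * n) (fun i => τ (plus n i)) Q ξ K (projWord n w)

variable {n : ℕ} {τ : ℕ → ℤ} {Q : DynkinQuiver (2 * n)} {ξ : ℕ → ℤ} {K : ℤ} {w : List ℕ}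

theorem CoordRun.isLabel_projWord (h : CoordRun n τ Q ξ K w) {k j : ℕ} (hk : w[k]? = some j)
    (hj : j ≠ n + 1) : ∃ i, 1 ≤ i ∧ plus n i = j ∧
      (projWord n w)[(projWord n (w.take k)).length]? = some i ∧
      (projWord n w).take (projWord n (w.take k)).length = projWord n (w.take k) := by
  have hr := h.reduced.mem_range j (List.mem_of_getElem? hk)
  obtain ⟨i, h1, h2, h3, h4⟩ := exists_plus hr.1 hr.2 hj
  have e : projWord n w = projWord n (w.take k) ++ ([i] ++ projWord n (w.drop (k + 1))) := by
    rw [← h4, ← projWord_append, ← projWord_append, ← List.append_assoc, ← take_succ_eq hk,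
      List.take_append_drop]
  refine ⟨i, h1, h3, ?_, ?_⟩
  · rw [e, List.getElem?_append_right le_rfl]; simp
  · rw [e, List.take_left]

/-- Middle times are odd and all others even, which leaves the gap `1` next to the middle letter.
Adjacent letters on one side have residues differing by `2` modulo `4`, which leaves the gap `2`. -/
theorem CoordRun.times_of_posArrow (h : CoordRun n τ Q ξ K w) {k l : ℕ} (ha : PosArrow w k l) :
    ∃ a b S T, At (twistedStep n) τ w k a S ∧ At (twistedStep n) τ w l b T ∧
      (a = b + 1 ∨ b = a + 1) ∧ S = T + if a = n + 1 ∨ b = n + 1 then 1 else 2 := by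
  obtain ⟨a, b, S, T, hA, hB, hab, h1, h2, h3⟩ :=
    exists_at_of_posArrow (twistedStep_pos n) h.valid h.run ha
  refine ⟨a, b, S, T, hA, hB, hab, ?_⟩
  have ra := h.reduced.mem_range a (List.mem_of_getElem? hA.1)
  have rb := h.reduced.mem_range b (List.mem_of_getElem? hB.1)
  have ea := h.residues.final (w.take k) a ra.1 ra.2
  have eb := h.residues.final (w.take l) b rb.1 rb.2
  rw [hA.2] at ea
  rw [hB.2] at eb
  simp only [twistedStep] at h2 h3
  split_ifs at * <;> omega

theorem At.letter_unique {st η : ℕ → ℤ} {k i j : ℕ} {T : ℤ} (h : At st η w k i T)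
    (hj : w[k]? = some j) : i = j := by
  have := h.1.symm.trans hj
  simpa using this

theorem CoordRun.at_of_vertexCoord (h : CoordRun n τ Q ξ K w) {k i : ℕ} {p : ℚ}
    (hp : VertexCoord n w Q ξ k i p) :
    ∃ T : ℤ, At (twistedStep n) τ w k i T ∧ p = ((K : ℚ) - T) / 2 := by
  induction hp with
  | induced k j i γ p hk hj hγ hp =>
    obtain ⟨i', h1, h2, h3, h4⟩ := h.isLabel_projWord hk hj
    obtain rfl : i' = i := by simpa using h3.symm.trans hγ.1
    have e := (h.proj.coord_iff hγ).mp hp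
    rw [h4, final_projWord h1
      fun j hj => (h.reduced.mem_range j (List.mem_of_mem_take hj)).1] at e
    refine ⟨_, ⟨h2 ▸ hk, rfl⟩, ?_⟩
    have e' : (2 : ℚ) * p = K - (final (twistedStep n) τ (w.take k) (plus n i') : ℤ) := by
      exact_mod_cast e
    linarith
  | sink k l j p hk hs ha hp ih =>
    obtain ⟨T, hT, rfl⟩ := ih
    obtain ⟨a, b, S, S', hA, hB, hab, hS⟩ := h.times_of_posArrow ha
    obtain rfl := hA.letter_unique hT.1
    obtain rfl := hB.letter_unique hk
    obtain rfl : S = T := hA.2.symm.trans hT.2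
    refine ⟨S', hB, ?_⟩
    rw [if_pos (Or.inr rfl)] at hS
    rw [hS]; push_cast; ring
  | source k l j p hk hs ha hp ih =>
    obtain ⟨T, hT, rfl⟩ := ih
    obtain ⟨a, b, S, S', hA, hB, hab, hS⟩ := h.times_of_posArrow ha
    obtain rfl := hB.letter_unique hT.1
    obtain rfl := hA.letter_unique hk
    obtain rfl : S' = T := hB.2.symm.trans hT.2
    refine ⟨S, hA, ?_⟩
    rw [if_pos (Or.inl rfl)] at hS
    rw [hS]; push_cast; ring
  | middle k l l' j j' p hk ha ha' hj hp hp' ih ih' =>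
    obtain ⟨T, hT, rfl⟩ := ih
    obtain ⟨a, b, S, S', hA, hB, hab, hS⟩ := h.times_of_posArrow ha
    obtain rfl := hA.letter_unique hT.1
    obtain rfl := hB.letter_unique hk
    obtain rfl : S = T := hA.2.symm.trans hT.2
    refine ⟨S', hB, ?_⟩
    rw [if_pos (Or.inr rfl)] at hS
    rw [hS]; push_cast; ring

/-- This converse is needed only away from the middle letter, since `n+1` is never a mesh neighbour.
-/
theorem CoordRun.vertexCoord_of_at (h : CoordRun n τ Q ξ K w) {k j : ℕ} {T : ℤ}
    (hT : At (twistedStep n) τ w k j T) (hj : j ≠ n + 1) :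
    VertexCoord n w Q ξ k j (((K : ℚ) - T) / 2) := by
  obtain ⟨i, h1, rfl, h3, h4⟩ := h.isLabel_projWord hT.1 hj
  have hl : IsLabel (projWord n w) (projWord n (w.take k)).length i _ := ⟨h3, rfl⟩
  have hp := h.proj.coord_of_label _ hl rfl
  have e := (h.proj.coord_iff hl).mp hp
  rw [h4, final_projWord h1
    fun j hj => (h.reduced.mem_range j (List.mem_of_mem_take hj)).1, hT.2] at e
  have e' : ((ξ i - 2 * ((projWord n (w.take k)).count i : ℤ) : ℤ) : ℚ) = ((K : ℚ) - T) / 2 := by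
    have : (2 : ℚ) * ((ξ i - 2 * ((projWord n (w.take k)).count i : ℤ) : ℤ) : ℚ) = K - T := by
      exact_mod_cast e
    linarith
  rw [← e']
  rw [h4] at hp
  exact VertexCoord.induced k _ i _ _ hT.1 hj hl (by rwa [h4])

theorem CoordRun.exists_at_of_coord (h : CoordRun n τ Q ξ K w) {γ : Lattice} {i : ℕ} {p : ℚ}
    (hp : Coord n w Q ξ γ i p) : ∃ (k : ℕ) (T : ℤ), IsLabel w k i γ ∧
      At (twistedStep n) τ w k i T ∧ p = ((K : ℚ) - T) / 2 := by
  obtain ⟨k, hl, hk⟩ := hp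
  obtain ⟨T, hT, e⟩ := h.at_of_vertexCoord hk
  exact ⟨k, T, hl, hT, e⟩

theorem CoordRun.coord_of_at (h : CoordRun n τ Q ξ K w) {k j : ℕ} {T : ℤ} {γ : Lattice}
    (hl : IsLabel w k j γ) (hT : At (twistedStep n) τ w k j T) (hj : j ≠ n + 1) :
    Coord n w Q ξ γ j (((K : ℚ) - T) / 2) :=
  ⟨k, hl, h.vertexCoord_of_at hT hj⟩

/-! ### The mesh relations -/

section

variable {m : ℕ} {st η : ℕ → ℤ} {w : List ℕ}

theorem At.label (hw : IsRun m st η w) {k i : ℕ} {T : ℤ} (h : At st η w k i T) :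
    act (weyl (w.take k)) (simpleRoot i) = weight (w.take k) i - weight (w.take (k + 1)) i := by
  rw [take_succ_eq h.1, label_eq_weight_sub (hw.ready h.1).1]

theorem At.weight_eq_succ (hst : ∀ i, 0 < st i) (hv : Valid m st η) (hw : IsRun m st η w)
    {k l i : ℕ} {T : ℤ} (h : At st η w k i T) (hl : final st η (w.take l) i = T + st i) :
    weight (w.take (k + 1)) i = weight (w.take l) i :=
  weight_eq hst hv (hw.take _) (hw.take _) (h.final_succ.trans hl.symm)

/-- The weight of `i` just after its first reading is the one just before the second. It cancels
when `fundWeight_add`, transported to the two positions, is subtracted. -/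
theorem At.label_add_label (hst : ∀ i, 0 < st i) (hv : Valid m st η) (hw : IsRun m st η w)
    {k k' i : ℕ} {T : ℤ} (h : At st η w k i T) (h' : At st η w k' i (T + st i)) :
    act (weyl (w.take k)) (simpleRoot i) + act (weyl (w.take k')) (simpleRoot i) =
      (weight (w.take k) (i - 1) - weight (w.take k') (i - 1)) +
      (weight (w.take k) (i + 1) - weight (w.take k') (i + 1)) := by
  have e1 := h.weight_eq_succ hst hv hw h'.2
  have e2 := weight_add_append (hw.ready h.1).1 (w.take k)
  have e3 := weight_add_append (hw.ready h.1).1 (w.take k')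
  rw [← take_succ_eq h.1] at e2
  rw [← take_succ_eq h'.1] at e3
  rw [h.label hw, h'.label hw, ← e1]
  rw [← e1] at e3
  calc _ = (weight (w.take k) i + weight (w.take (k + 1)) i) -
        (weight (w.take (k + 1)) i + weight (w.take (k' + 1)) i) := by abel
    _ = _ := by rw [e2, e3]; abel

theorem At.window (hst : ∀ i, 0 < st i) (hv : Valid m st η) (hw : IsRun m st η w)
    {k i j : ℕ} {T : ℤ} (h : At st η w k i T) (hj : 1 ≤ j) (hj' : j ≤ m)
    (hij : i = j + 1 ∨ j = i + 1) :
    T < final st η (w.take k) j ∧ final st η (w.take k) j < T + st j := by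
  have hi := hw.ready h.1
  have a := hv.final hst (hw.take k) j i hj hj' hi.1 hi.2.1 hij.symm
  have b := hi.2.2 j hj hj' hij
  rw [h.2] at a b
  omega

end

variable {n : ℕ} {τ : ℕ → ℤ} {Q : DynkinQuiver (2 * n)} {ξ : ℕ → ℤ} {K : ℤ} {w : List ℕ}

theorem CoordRun.weight_eq (h : CoordRun n τ Q ξ K w) {k l j : ℕ}
    (he : final (twistedStep n) τ (w.take k) j = final (twistedStep n) τ (w.take l) j) :
    weight (w.take k) j = weight (w.take l) j :=
  TwistedAR.weight_eq (twistedStep_pos n) h.valid (h.run.take _) (h.run.take _) he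

theorem CoordRun.weight_eq_of_notMem (h : CoordRun n τ Q ξ K w) {k l j : ℕ}
    (hj : ¬ (1 ≤ j ∧ j ≤ 2 * n + 1)) : weight (w.take k) j = weight (w.take l) j := by
  refine h.weight_eq ?_
  rw [final_eq_count, final_eq_count, List.count_eq_zero_of_not_mem,
    List.count_eq_zero_of_not_mem]
  · exact fun hm => hj (h.reduced.mem_range _ (List.mem_of_mem_take hm))
  · exact fun hm => hj (h.reduced.mem_range _ (List.mem_of_mem_take hm))

open scoped Classical in
/-- The sum of the positive roots with the coordinate `(j, (K - U) / 2)`. -/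
noncomputable def coordSum (n : ℕ) (w : List ℕ) (Q : DynkinQuiver (2 * n)) (ξ : ℕ → ℤ) (K : ℤ)
    (j : ℕ) (U : ℤ) : Lattice :=
  ∑ γ ∈ (posRoots (2 * n + 1)).filter (fun γ => Coord n w Q ξ γ j (((K : ℚ) - U) / 2)), γ

theorem CoordRun.time_eq {T U : ℤ} (h : ((K : ℚ) - T) / 2 = ((K : ℚ) - U) / 2) : T = U := by
  have : (T : ℚ) = U := by linarith
  exact_mod_cast this

open scoped Classical in
theorem CoordRun.coordSum_of_at (h : CoordRun n τ Q ξ K w) {l j : ℕ} {U : ℤ}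
    (hl : At (twistedStep n) τ w l j U) (hj : j ≠ n + 1) :
    coordSum n w Q ξ K j U = act (weyl (w.take l)) (simpleRoot j) := by
  have hlab : IsLabel w l j (act (weyl (w.take l)) (simpleRoot j)) := ⟨hl.1, rfl⟩
  rw [coordSum, Finset.sum_eq_single_of_mem (act (weyl (w.take l)) (simpleRoot j))]
  · exact Finset.mem_filter.mpr ⟨h.reduced.label_mem hlab, h.coord_of_at hlab hl hj⟩
  · intro γ hγ hne
    obtain ⟨k, T, hk, hT, e⟩ := h.exists_at_of_coord (Finset.mem_filter.mp hγ).2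
    obtain rfl := CoordRun.time_eq e
    obtain rfl := hl.unique (twistedStep_pos n) hT
    exact absurd hk.2 hne

open scoped Classical in
theorem CoordRun.coordSum_of_not_at (h : CoordRun n τ Q ξ K w) {j : ℕ} {U : ℤ}
    (hl : ∀ l, ¬ At (twistedStep n) τ w l j U) : coordSum n w Q ξ K j U = 0 := by
  rw [coordSum, Finset.filter_false_of_mem, Finset.sum_empty]
  intro γ _ hγ
  obtain ⟨k, T, hk, hT, e⟩ := h.exists_at_of_coord hγ
  obtain rfl := CoordRun.time_eq e
  exact hl k hT

open scoped Classical in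
theorem CoordRun.sum_filter (h : CoordRun n τ Q ξ K w) {j₁ j₂ : ℕ} (hj : j₁ ≠ j₂) {P : ℕ → Prop}
    (hP : ∀ j, P j ↔ j = j₁ ∨ j = j₂) (U : ℤ) :
    ∑ γ ∈ (posRoots (2 * n + 1)).filter
      (fun γ => ∃ j, P j ∧ Coord n w Q ξ γ j (((K : ℚ) - U) / 2)), γ =
    coordSum n w Q ξ K j₁ U + coordSum n w Q ξ K j₂ U := by
  rw [coordSum, coordSum, ← Finset.sum_union]
  · refine Finset.sum_congr ?_ fun _ _ => rfl
    ext γ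
    simp only [Finset.mem_filter, Finset.mem_union, hP]
    constructor
    · rintro ⟨h1, j, rfl | rfl, h2⟩
      · exact Or.inl ⟨h1, h2⟩
      · exact Or.inr ⟨h1, h2⟩
    · rintro (⟨h1, h2⟩ | ⟨h1, h2⟩)
      · exact ⟨h1, _, Or.inl rfl, h2⟩
      · exact ⟨h1, _, Or.inr rfl, h2⟩
  · rw [Finset.disjoint_left]
    intro γ h1 h2
    obtain ⟨k, -, hk, -⟩ := h.exists_at_of_coord (Finset.mem_filter.mp h1).2
    obtain ⟨k', -, hk', -⟩ := h.exists_at_of_coord (Finset.mem_filter.mp h2).2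
    exact hj (h.reduced.label_injective hk hk').2

theorem CoordRun.residue (h : CoordRun n τ Q ξ K w) (k : ℕ) {i : ℕ} (h1 : 1 ≤ i)
    (h2 : i ≤ 2 * n + 1) :
    (i ≤ n → final (twistedStep n) τ (w.take k) i % 4 = (2 * i) % 4) ∧
    (i = n + 1 → final (twistedStep n) τ (w.take k) i % 2 = 1) ∧
    (n + 2 ≤ i → final (twistedStep n) τ (w.take k) i % 4 = (2 * i + 2) % 4) :=
  h.residues.final (w.take k) i h1 h2

/-- The difference of weights across an interval that contains one occurrence of the letter. -/
theorem CoordRun.weight_sub_of_at (h : CoordRun n τ Q ξ K w) {k k' l j : ℕ} {U : ℤ}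
    (hl : At (twistedStep n) τ w l j U) (h1 : final (twistedStep n) τ (w.take k) j = U)
    (h2 : final (twistedStep n) τ (w.take k') j = U + twistedStep n j) :
    weight (w.take k) j - weight (w.take k') j = act (weyl (w.take l)) (simpleRoot j) := by
  rw [hl.label h.run, h.weight_eq (h1.trans hl.2.symm),
    h.weight_eq (h2.trans hl.final_succ.symm)]

/-- The contribution of a neighbour in the untwisted part of the quiver. -/
theorem CoordRun.weight_sub_plain (h : CoordRun n τ Q ξ K w) {k k' i j : ℕ} {T : ℤ}
    (hk : At (twistedStep n) τ w k i T) (hk' : At (twistedStep n) τ w k' i (T + 4))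
    (hi : i ≠ n + 1) (hj : j ≠ n + 1) (hij : i = j + 1 ∨ j = i + 1) :
    weight (w.take k) j - weight (w.take k') j = coordSum n w Q ξ K j (T + 2) := by
  have hir := h.reduced.mem_range i (List.mem_of_getElem? hk.1)
  by_cases hjr : 1 ≤ j ∧ j ≤ 2 * n + 1
  · have a := hk.window (twistedStep_pos n) h.valid h.run hjr.1 hjr.2 hij
    have b := hk'.window (twistedStep_pos n) h.valid h.run hjr.1 hjr.2 hij
    have c := h.residue k hjr.1 hjr.2
    have c' := h.residue k' hjr.1 hjr.2
    have d := h.residue k hir.1 hir.2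
    have e := h.residues j hjr.1 hjr.2
    have hst : twistedStep n j = 4 := if_neg hj
    rw [hk.2] at d
    rw [hst] at a b
    -- The letters lie on the same side of the middle, so residues force the next times `T + 2` and
    -- `T + 6` of `j` at the two positions: exactly one reading in between.
    obtain ⟨l, hl⟩ := hk.exists_between (twistedStep_pos n) h.valid h.run hk' hjr.1 hjr.2 hij
      (U := T + 2) (by omega) (by omega) ⟨(T + 2 - τ j) / 4, by rw [hst]; omega⟩
    rw [h.coordSum_of_at hl hj]
    exact h.weight_sub_of_at hl (by omega) (by rw [hst]; omega)
  · rw [h.weight_eq_of_notMem (l := k') hjr, sub_self, h.coordSum_of_not_at]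
    exact fun l hl => hjr (h.reduced.mem_range j (List.mem_of_getElem? hl.1))

/-- The contribution of the neighbours of the middle letter. -/
theorem CoordRun.weight_sub_middle (h : CoordRun n τ Q ξ K w) (hn : 1 ≤ n) {k k' j : ℕ} {T : ℤ}
    (hk : At (twistedStep n) τ w k (n + 1) T) (hk' : At (twistedStep n) τ w k' (n + 1) (T + 2))
    (hj : j = n ∨ j = n + 2) :
    weight (w.take k) j - weight (w.take k') j = coordSum n w Q ξ K j (T + 1) := by
  have hjr : 1 ≤ j ∧ j ≤ 2 * n + 1 := by omega
  have hij : n + 1 = j + 1 ∨ j = n + 1 + 1 := by omega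
  have a := hk.window (twistedStep_pos n) h.valid h.run hjr.1 hjr.2 hij
  have b := hk'.window (twistedStep_pos n) h.valid h.run hjr.1 hjr.2 hij
  have c := h.residue k hjr.1 hjr.2
  have c' := h.residue k' hjr.1 hjr.2
  have d := (h.residue k (i := n + 1) (by omega) (by omega)).2.1 rfl
  have e := h.residues j hjr.1 hjr.2
  have hst : twistedStep n j = 4 := if_neg (by omega)
  rw [hk.2] at d
  rw [hst] at a b
  -- The middle letter returns after `2`, its neighbours after `4`. Either `j` is read at `T + 1`,
  -- or its next time is `T + 3` at both positions and neither side has a term.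
  by_cases hc : (T + 1 - τ j) % 4 = 0
  · obtain ⟨l, hl⟩ := hk.exists_between (twistedStep_pos n) h.valid h.run hk' hjr.1 hjr.2 hij
      (U := T + 1) (by omega) (by omega) ⟨(T + 1 - τ j) / 4, by rw [hst]; omega⟩
    rw [h.coordSum_of_at hl (by omega)]
    exact h.weight_sub_of_at hl (by omega) (by rw [hst]; omega)
  · rw [h.coordSum_of_not_at, h.weight_eq (l := k'), sub_self]
    · omega
    · intro l hl
      have f := h.residue l hjr.1 hjr.2
      rw [hl.2] at f
      omega

/-- Between consecutive occurrences of one neighbour of the middle letter, the middle letter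
occurs twice, and the other neighbour occurs once in between. -/
theorem CoordRun.exists_around_middle (h : CoordRun n τ Q ξ K w) (hn : 1 ≤ n) {k k' c d : ℕ}
    {T : ℤ} (hk : At (twistedStep n) τ w k c T) (hk' : At (twistedStep n) τ w k' c (T + 4))
    (hcd : (c = n ∧ d = n + 2) ∨ (c = n + 2 ∧ d = n)) : ∃ l₁ l l₂,
      At (twistedStep n) τ w l₁ (n + 1) (T + 1) ∧ At (twistedStep n) τ w l d (T + 2) ∧
      At (twistedStep n) τ w l₂ (n + 1) (T + 3) := by
  have e := (h.residues (n + 1) (by omega) (by omega)).2.1 rfl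
  have r := h.residue k (i := c) (by omega) (by omega)
  have r' := h.residues d (by omega) (by omega)
  have hst : twistedStep n (n + 1) = 2 := if_pos rfl
  have hst' : twistedStep n d = 4 := if_neg (by omega)
  rw [hk.2] at r
  obtain ⟨l₁, hl₁⟩ := hk.exists_between (twistedStep_pos n) h.valid h.run hk' (j := n + 1)
    (U := T + 1) (by omega) (by omega) (by omega) (by omega) (by omega)
    ⟨(T + 1 - τ (n + 1)) / 2, by rw [hst]; omega⟩
  obtain ⟨l₂, hl₂⟩ := hk.exists_between (twistedStep_pos n) h.valid h.run hk' (j := n + 1)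
    (U := T + 3) (by omega) (by omega) (by omega) (by omega) (by omega)
    ⟨(T + 3 - τ (n + 1)) / 2, by rw [hst]; omega⟩
  obtain ⟨l, hl⟩ := hl₁.exists_between (twistedStep_pos n) h.valid h.run hl₂ (j := d)
    (U := T + 2) (by omega) (by omega) (by omega) (by omega) (by omega)
    ⟨(T + 2 - τ d) / 4, by rw [hst']; omega⟩
  exact ⟨l₁, l, l₂, hl₁, hl, hl₂⟩

theorem CoordRun.final_middle (h : CoordRun n τ Q ξ K w) {k c : ℕ} {T : ℤ}
    (hk : At (twistedStep n) τ w k c T) (hc : c = n ∨ c = n + 2) :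
    final (twistedStep n) τ (w.take k) (n + 1) = T + 1 := by
  have hcr := h.reduced.mem_range c (List.mem_of_getElem? hk.1)
  have r := h.residue k hcr.1 hcr.2
  have t := (h.residue k (i := n + 1) (by omega) (by omega)).2.1 rfl
  have a := hk.window (twistedStep_pos n) h.valid h.run (j := n + 1) (by omega) (by omega)
    (by omega)
  rw [hk.2] at r
  rw [twistedStep, if_pos rfl] at a
  omega

/-- When the middle letter is read at `T`, the next time of `d` lies strictly between `T` and `T +
4`, so its residue, known from any other prefix, determines it. -/
theorem CoordRun.final_beside (h : CoordRun n τ Q ξ K w) {l l' d : ℕ} {T U U' : ℤ}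
    (hl : At (twistedStep n) τ w l (n + 1) T) (hd : (d = n ∧ 1 ≤ n) ∨ d = n + 2 ∧ 1 ≤ n)
    (hd' : final (twistedStep n) τ (w.take l') d = U') (hU : (U - U') % 4 = 0) (h1 : T < U)
    (h2 : U < T + 4) : final (twistedStep n) τ (w.take l) d = U := by
  have a := hl.window (twistedStep_pos n) h.valid h.run (j := d) (by omega) (by omega)
    (by omega)
  rw [twistedStep, if_neg (by omega)] at a
  rw [final_eq_count, twistedStep, if_neg (by omega)] at a hd' ⊢
  omega

/-- The contribution of the middle letter. -/
theorem CoordRun.weight_sub_across (h : CoordRun n τ Q ξ K w) (hn : 1 ≤ n) {k k' c d : ℕ}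
    {T : ℤ} (hk : At (twistedStep n) τ w k c T) (hk' : At (twistedStep n) τ w k' c (T + 4))
    (hcd : (c = n ∧ d = n + 2) ∨ (c = n + 2 ∧ d = n)) :
    weight (w.take k) (n + 1) - weight (w.take k') (n + 1) = coordSum n w Q ξ K d (T + 2) := by
  obtain ⟨l₁, l, l₂, hl₁, hl, hl₂⟩ := h.exists_around_middle hn hk hk' hcd
  have hst : twistedStep n (n + 1) = 2 := if_pos rfl
  have hstd : twistedStep n d = 4 := if_neg (by omega)
  have fk := h.final_middle hk (by omega)
  have fk' := h.final_middle hk' (by omega)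
  have fc₁ := h.final_beside (U := T + 4) hl₁ (d := c) (by omega) hk.2 (by omega) (by omega)
    (by omega)
  have fc₂ := h.final_beside (U := T + 4) hl₂ (d := c) (by omega) hk.2 (by omega) (by omega)
    (by omega)
  have fd₁ := h.final_beside (U := T + 2) hl₁ (d := d) (by omega) hl.2 (by omega) (by omega)
    (by omega)
  have fd₂ := h.final_beside (U := T + 2 + 4) hl₂ (d := d) (by omega) hl.2 (by omega) (by omega)
    (by omega)
  have hl₂' : At (twistedStep n) τ w l₂ (n + 1) (T + 1 + twistedStep n (n + 1)) := by
    rw [hst, show T + 1 + 2 = T + 3 by ring]; exact hl₂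
  have e := hl₁.label_add_label (twistedStep_pos n) h.valid h.run hl₂'
  -- The letter `c` is read at `T` and `T + 4`, hence not between the middle readings at `T + 1` and
  -- `T + 3`; only `d` contributes to this middle mesh.
  have ec : weight (w.take l₁) c = weight (w.take l₂) c :=
    h.weight_eq (fc₁.trans fc₂.symm)
  have ed := h.weight_sub_of_at (k := l₁) (k' := l₂) hl fd₁ (by rw [hstd, fd₂])
  rw [h.coordSum_of_at hl (by omega), ← ed]
  have e' : (weight (w.take l₁) (n + 1 - 1) - weight (w.take l₂) (n + 1 - 1)) +
      (weight (w.take l₁) (n + 1 + 1) - weight (w.take l₂) (n + 1 + 1)) =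
      weight (w.take l₁) d - weight (w.take l₂) d := by
    rcases hcd with ⟨rfl, rfl⟩ | ⟨rfl, rfl⟩
    · rw [Nat.add_sub_cancel, ec, sub_self, zero_add]
    · rw [Nat.add_sub_cancel, ec, sub_self, add_zero]
  -- The two middle labels telescope to the drop of the middle weight from time `T + 1`, its value
  -- at `k`, to `T + 5`, its value at `k'`.
  rw [← e', ← e, hl₁.label h.run, hl₂.label h.run,
    hl₁.weight_eq_succ (twistedStep_pos n) h.valid h.run hl₂'.2, sub_add_sub_cancel,
    h.weight_eq (k := k) (l := l₁) (by rw [hl₁.2, fk]),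
    h.weight_eq (k := k') (l := l₂ + 1) (by rw [hl₂.final_succ, hst, fk']; ring)]

theorem exists_meshNeighbours {n i : ℕ} (hn : 1 ≤ n) (hi : 1 ≤ i) : ∃ j₁ j₂, j₁ ≠ j₂ ∧
    (∀ j, MeshNeighbour n i j ↔ j = j₁ ∨ j = j₂) ∧
    ((i = n + 2 ∧ j₁ = n ∧ j₂ = n + 3) ∨ (i = n ∧ j₁ = n - 1 ∧ j₂ = n + 2) ∨
      (i ≠ n + 2 ∧ i ≠ n ∧ j₁ = i - 1 ∧ j₂ = i + 1)) := by
  by_cases h1 : i = n + 2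
  · exact ⟨n, n + 3, by omega, fun j => by rw [MeshNeighbour, if_pos h1], by omega⟩
  by_cases h2 : i = n
  · exact ⟨n - 1, n + 2, by omega, fun j => by rw [MeshNeighbour, if_neg h1, if_pos h2]; omega,
      by omega⟩
  · exact ⟨i - 1, i + 1, by omega, fun j => by rw [MeshNeighbour, if_neg h1, if_neg h2]; omega,
      by omega⟩

open scoped Classical in
/-- The mesh relation in terms of times. -/
theorem CoordRun.mesh (h : CoordRun n τ Q ξ K w) (hn : 1 ≤ n) {k k' i : ℕ} {T U : ℤ}
    (hk : At (twistedStep n) τ w k i T)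
    (hk' : At (twistedStep n) τ w k' i (T + twistedStep n i))
    (hU : U = T + if i = n + 1 then 1 else 2) :
    act (weyl (w.take k)) (simpleRoot i) + act (weyl (w.take k')) (simpleRoot i) =
      ∑ γ ∈ (posRoots (2 * n + 1)).filter
        (fun γ => ∃ j, MeshNeighbour n i j ∧ Coord n w Q ξ γ j (((K : ℚ) - U) / 2)), γ := by
  have hir := h.reduced.mem_range i (List.mem_of_getElem? hk.1)
  obtain ⟨j₁, j₂, hne, hP, hj⟩ := exists_meshNeighbours hn hir.1
  rw [h.sum_filter hne hP, hk.label_add_label (twistedStep_pos n) h.valid h.run hk']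
  by_cases hi : i = n + 1
  · subst hi
    obtain ⟨rfl, rfl⟩ : j₁ = n + 1 - 1 ∧ j₂ = n + 1 + 1 := by omega
    rw [if_pos rfl] at hU
    rw [twistedStep, if_pos rfl] at hk'
    rw [hU, h.weight_sub_middle hn hk hk' (by omega), h.weight_sub_middle hn hk hk' (by omega),
      Nat.add_sub_cancel]
  · rw [if_neg hi] at hU
    rw [twistedStep, if_neg hi] at hk'
    rw [hU]
    rcases hj with ⟨rfl, rfl, rfl⟩ | ⟨rfl, rfl, rfl⟩ | ⟨h1, h2, rfl, rfl⟩
    · rw [← h.weight_sub_across hn hk hk' (Or.inr ⟨rfl, rfl⟩),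
        ← h.weight_sub_plain hk hk' hi (by omega) (by omega)]
      rfl
    · rw [← h.weight_sub_across hn hk hk' (Or.inl ⟨rfl, rfl⟩),
        ← h.weight_sub_plain hk hk' hi (by omega) (by omega)]
    · rw [← h.weight_sub_plain hk hk' hi (by omega) (by omega),
        ← h.weight_sub_plain hk hk' hi (by omega) (by omega)]

/-! ### Paths -/

theorem CoordRun.rootArrow_times (h : CoordRun n τ Q ξ K w) {α γ : Lattice}
    (ha : RootArrow w α γ) {k i : ℕ} {T : ℤ} (hl : IsLabel w k i α)
    (hT : At (twistedStep n) τ w k i T) : ∃ l j U, IsLabel w l j γ ∧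
      At (twistedStep n) τ w l j U ∧ (i = j + 1 ∨ j = i + 1) ∧
      T = U + if i = n + 1 ∨ j = n + 1 then 1 else 2 := by
  obtain ⟨k', l, a, b, hk, hl', hp⟩ := ha
  obtain ⟨rfl, rfl⟩ := h.reduced.label_injective hl hk
  obtain ⟨a, b', S, U, hA, hB, hab, hS⟩ := h.times_of_posArrow hp
  obtain rfl := hA.letter_unique hT.1
  obtain rfl := hB.letter_unique hl'.1
  obtain rfl : S = T := hA.2.symm.trans hT.2
  exact ⟨l, b', U, hl', hB, hab, hS⟩

theorem CoordRun.path_le (h : CoordRun n τ Q ξ K w) {α γ : Lattice}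
    (hp : Relation.ReflTransGen (RootArrow w) α γ) {k i l j : ℕ} {T U : ℤ}
    (hl : IsLabel w k i α) (hT : At (twistedStep n) τ w k i T)
    (hl' : IsLabel w l j γ) (hU : At (twistedStep n) τ w l j U) :
    U ≤ T ∧ (U = T → i = j) := by
  induction hp using Relation.ReflTransGen.head_induction_on generalizing k i T with
  | refl =>
    obtain ⟨rfl, rfl⟩ := h.reduced.label_injective hl hl'
    exact ⟨(hU.2.symm.trans hT.2).le, fun _ => rfl⟩
  | head ha _ ih =>
    obtain ⟨l', j', U', h1, h2, -, h3⟩ := h.rootArrow_times ha hl hT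
    have := (ih h1 h2).1
    split_ifs at h3 <;> exact ⟨by omega, by omega⟩

/-- A path that starts at the end of a mesh and has half its length leads to a mesh neighbour. -/
theorem CoordRun.meshNeighbour_of_path (h : CoordRun n τ Q ξ K w) {α γ : Lattice}
    (hp : Relation.ReflTransGen (RootArrow w) α γ) {k i l j : ℕ} {T U : ℤ}
    (hl : IsLabel w k i α) (hT : At (twistedStep n) τ w k i T)
    (hl' : IsLabel w l j γ) (hU : At (twistedStep n) τ w l j U)
    (hTU : T = U + if i = n + 1 then 1 else 2) : MeshNeighbour n i j := by
  have ri := h.residue k (h.reduced.mem_range i (List.mem_of_getElem? hT.1)).1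
    (h.reduced.mem_range i (List.mem_of_getElem? hT.1)).2
  have rj := h.residue l (h.reduced.mem_range j (List.mem_of_getElem? hU.1)).1
    (h.reduced.mem_range j (List.mem_of_getElem? hU.1)).2
  rw [hT.2] at ri
  rw [hU.2] at rj
  rcases hp.cases_head with rfl | ⟨γ₁, ha₁, hp₁⟩
  · obtain ⟨rfl, rfl⟩ := h.reduced.label_injective hl hl'
    have := hT.2.symm.trans hU.2
    split_ifs at hTU <;> omega
  obtain ⟨l₁, j₁, U₁, hl₁, hU₁, hij₁, hT₁⟩ := h.rootArrow_times ha₁ hl hT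
  by_cases hi : i = n + 1
  · rw [if_pos hi] at hTU
    rw [if_pos (Or.inl hi)] at hT₁
    have := (h.path_le hp₁ hl₁ hU₁ hl' hU).2 (by omega)
    rw [MeshNeighbour, if_neg (by omega), if_neg (by omega)]
    omega
  rw [if_neg hi] at hTU
  by_cases hj₁ : j₁ = n + 1
  · rw [if_pos (Or.inr hj₁)] at hT₁
    -- A path through the middle letter has two arrows of length `1`. It crosses to the opposite
    -- letter, since returning to `i` after time `2` contradicts its residue modulo `4`.
    rcases hp₁.cases_head with rfl | ⟨γ₂, ha₂, hp₂⟩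
    · obtain ⟨rfl, rfl⟩ := h.reduced.label_injective hl₁ hl'
      have := hU₁.2.symm.trans hU.2
      omega
    obtain ⟨l₂, j₂, U₂, hl₂, hU₂, hij₂, hT₂⟩ := h.rootArrow_times ha₂ hl₁ hU₁
    rw [if_pos (Or.inl hj₁)] at hT₂
    have := (h.path_le hp₂ hl₂ hU₂ hl' hU).2 (by omega)
    rw [MeshNeighbour]
    split_ifs <;> omega
  · rw [if_neg (by omega)] at hT₁
    have := (h.path_le hp₁ hl₁ hU₁ hl' hU).2 (by omega)
    rw [MeshNeighbour]
    split_ifs <;> omega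

theorem CoordRun.rootArrow_of_at (h : CoordRun n τ Q ξ K w) {α γ : Lattice} {k l i j : ℕ}
    {T U : ℤ} (hl : IsLabel w k i α) (hT : At (twistedStep n) τ w k i T)
    (hl' : IsLabel w l j γ) (hU : At (twistedStep n) τ w l j U) (hij : i = j + 1 ∨ j = i + 1)
    (hTU : T = U + if i = n + 1 ∨ j = n + 1 then 1 else 2) : RootArrow w α γ := by
  refine ⟨k, l, i, j, hl, hl', hT.posArrow (twistedStep_pos n) h.run hU hij ?_ ?_ ?_⟩
  · split_ifs at hTU <;> omega
  · rw [twistedStep]; split_ifs at hTU ⊢ <;> omega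
  · rw [twistedStep]; split_ifs at hTU ⊢ <;> omega

/-- An ordinary mesh neighbour is joined to both ends by arrows; the opposite letter of a mesh at
`n` or `n+2` is reached through the middle vertices at `T + 3` and `T + 1`. -/
theorem CoordRun.onPath_of_meshNeighbour (h : CoordRun n τ Q ξ K w) (hn : 1 ≤ n)
    {α β γ : Lattice} {k k' l i j : ℕ} {T U : ℤ}
    (hβ : IsLabel w k i β) (hk : At (twistedStep n) τ w k i T)
    (hα : IsLabel w k' i α) (hk' : At (twistedStep n) τ w k' i (T + twistedStep n i))
    (hγ : IsLabel w l j γ) (hl : At (twistedStep n) τ w l j U)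
    (hU : U = T + if i = n + 1 then 1 else 2) (hm : MeshNeighbour n i j) : OnPath w α β γ := by
  have hst : twistedStep n i = if i = n + 1 then 2 else 4 := rfl
  have hij : (i = j + 1 ∨ j = i + 1) ∧ (i = n + 1 ∨ j ≠ n + 1) ∨
      ((i = n ∧ j = n + 2) ∨ (i = n + 2 ∧ j = n)) := by
    rw [MeshNeighbour] at hm
    split_ifs at hm <;> omega
  rcases hij with ⟨hij, hnot⟩ | hij
  · refine ⟨.single (h.rootArrow_of_at hα hk' hγ hl hij ?_),
      .single (h.rootArrow_of_at hγ hl hβ hk hij.symm ?_)⟩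
    · split_ifs at * <;> omega
    · split_ifs at * <;> omega
  · rw [if_neg (by omega)] at hst hU
    rw [hst] at hk'
    obtain ⟨l₁, l', l₂, hl₁, -, hl₂⟩ := h.exists_around_middle hn hk hk' hij
    have hγ₁ : IsLabel w l₁ (n + 1) _ := ⟨hl₁.1, rfl⟩
    have hγ₂ : IsLabel w l₂ (n + 1) _ := ⟨hl₂.1, rfl⟩
    have e1 : ∀ x, (if n + 1 = n + 1 ∨ x = n + 1 then (1 : ℤ) else 2) = 1 := by simp
    have e2 : ∀ x, (if x = n + 1 ∨ n + 1 = n + 1 then (1 : ℤ) else 2) = 1 := by simp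
    refine ⟨.head (h.rootArrow_of_at hα hk' hγ₂ hl₂ (by omega) (by rw [e2]; ring))
        (.single (h.rootArrow_of_at hγ₂ hl₂ hγ hl (by omega) (by rw [e1]; omega))),
      .head (h.rootArrow_of_at hγ hl hγ₁ hl₁ (by omega) (by rw [e2]; omega))
        (.single (h.rootArrow_of_at hγ₁ hl₁ hβ hk (by omega) (by rw [e1])))⟩

/-! ### Folded coordinates -/

theorem orbitSize_orbitRep {n i : ℕ} (hi' : i ≤ 2 * n + 1) :
    orbitSize n (orbitRep n i) = if i = n + 1 then 1 else 2 := by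
  rw [orbitSize]
  split_ifs with h
  · have : orbitRep n i = n + 1 ∧ vee n (n + 1) = n + 1 := by
      simp only [orbitRep, vee]; omega
    rw [this.1, this.2]; simp
  · rw [Finset.card_pair]
    simp only [orbitRep, vee]; omega

theorem CoordRun.exists_at_of_foldedCoord (h : CoordRun n τ Q ξ K w) {γ : Lattice} {i : ℕ} {s : ℤ}
    (hp : FoldedCoord n w Q ξ γ i s) : ∃ k j, i = orbitRep n j ∧ IsLabel w k j γ ∧
      At (twistedStep n) τ w k j (K - s) := by
  obtain ⟨j, hj, hc⟩ := hp
  obtain ⟨k, T, hl, hT, e⟩ := h.exists_at_of_coord hc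
  have : T = K - s := by
    have : (T : ℚ) = K - s := by linarith
    exact_mod_cast this
  exact ⟨k, j, hj, hl, this ▸ hT⟩

/-- For `i ≠ n+1` the times of `i` and `i^∨` differ by `2` modulo `4`, whereas the two given times
differ by `4`; folding therefore loses no information here. -/
theorem CoordRun.letter_eq_of_orbitRep_eq (h : CoordRun n τ Q ξ K w) {k k' i i' : ℕ} {T : ℤ}
    (hi : At (twistedStep n) τ w k i T)
    (hi' : At (twistedStep n) τ w k' i' (T + 2 ^ orbitSize n (orbitRep n i)))
    (he : orbitRep n i = orbitRep n i') : i = i' := by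
  have r := h.reduced.mem_range i (List.mem_of_getElem? hi.1)
  have r' := h.reduced.mem_range i' (List.mem_of_getElem? hi'.1)
  have c := h.residue k r.1 r.2
  have c' := h.residue k' r'.1 r'.2
  rw [hi.2] at c
  rw [hi'.2, orbitSize_orbitRep r.2] at c'
  simp only [orbitRep, vee] at he
  split_ifs at c' with hc
  · omega
  · norm_num at c'
    omega

end TwistedAR

/-! ### Both forms of the mesh relation -/

open TwistedAR in
open scoped Classical in
theorem mainTheorem6 (n : ℕ) (hn : 1 ≤ n) (w : List ℕ) (hw : IsTwistedAdapted n w)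
    (Q : DynkinQuiver (2 * n)) (hQ : Q.Adapted (projWord n w))
    (ξ : ℕ → ℤ) (hξ : Q.IsHeight ξ) :
    (∀ α ∈ posRoots (2 * n + 1), ∀ β ∈ posRoots (2 * n + 1), ∀ (i : ℕ) (p : ℚ),
      Coord n w Q ξ β i p → Coord n w Q ξ α i (p - 2 + delta i (n + 1)) →
      β + α = ∑ γ ∈ (posRoots (2 * n + 1)).filter
        (fun γ => ∃ j, MeshNeighbour n i j ∧
          Coord n w Q ξ γ j (p - 1 / (1 + delta i (n + 1)))), γ) ∧
    (∀ α ∈ posRoots (2 * n + 1), ∀ β ∈ posRoots (2 * n + 1), ∀ (i : ℕ) (s : ℤ),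
      FoldedCoord n w Q ξ β i s → FoldedCoord n w Q ξ α i (s - 2 ^ orbitSize n i) →
      α + β = ∑ γ ∈ (posRoots (2 * n + 1)).filter
        (fun γ => OnPath w α β γ ∧
          ∃ j, FoldedCoord n w Q ξ γ j (s - 2 ^ (orbitSize n i - 1))), γ) := by
  obtain ⟨τ, hτ⟩ := hw.exists_twistedRun
  obtain ⟨K, hK⟩ := hτ.adaptedRun hQ hξ
  have h : CoordRun n τ Q ξ K w := ⟨hτ, hK⟩
  constructor
  · intro α _ β _ i p hβ hα
    obtain ⟨k, T, hlβ, hk, rfl⟩ := h.exists_at_of_coord hβ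
    obtain ⟨k', T', hlα, hk', e⟩ := h.exists_at_of_coord hα
    have hT : T' = T + twistedStep n i := by
      have : (T' : ℚ) = T + twistedStep n i := by
        rw [delta] at e
        rw [twistedStep]
        split_ifs at e ⊢ <;> push_cast <;> linarith
      exact_mod_cast this
    subst hT
    have hq : ((K : ℚ) - T) / 2 - 1 / (1 + delta i (n + 1)) =
        ((K : ℚ) - (T + if i = n + 1 then 1 else 2 : ℤ)) / 2 := by
      rw [delta]
      split_ifs <;> push_cast <;> ring
    rw [hq, hlβ.2, hlα.2]
    exact h.mesh hn hk hk' rfl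
  · intro α _ β _ i s hβ hα
    obtain ⟨k, i₀, rfl, hlβ, hk⟩ := h.exists_at_of_foldedCoord hβ
    obtain ⟨k', i₁, hi₁, hlα, hk'⟩ := h.exists_at_of_foldedCoord hα
    have hir := h.reduced.mem_range i₀ (List.mem_of_getElem? hk.1)
    rw [sub_sub_eq_add_sub, add_sub_right_comm] at hk'
    obtain rfl := h.letter_eq_of_orbitRep_eq hk hk' hi₁
    rw [orbitSize_orbitRep hir.2] at *
    have hpow : (2 : ℤ) ^ (if i₀ = n + 1 then 1 else 2) = twistedStep n i₀ := by
      rw [twistedStep]; split_ifs <;> norm_num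
    have hpow' : (2 : ℤ) ^ ((if i₀ = n + 1 then 1 else 2) - 1) = if i₀ = n + 1 then 1 else 2 := by
      split_ifs <;> norm_num
    rw [hpow] at hk'
    rw [hpow', add_comm, hlβ.2, hlα.2, h.mesh hn hk hk' rfl]
    refine Finset.sum_congr (Finset.filter_congr fun γ _ => ?_) fun _ _ => rfl
    rw [← hlβ.2, ← hlα.2]
    set d : ℤ := if i₀ = n + 1 then 1 else 2 with hd
    have hd2 : twistedStep n i₀ = d + d := by rw [hd, twistedStep]; split_ifs <;> norm_num
    constructor
    · rintro ⟨j, hm, hc⟩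
      obtain ⟨l, U, hlγ, hl, e⟩ := h.exists_at_of_coord hc
      obtain rfl := CoordRun.time_eq e
      refine ⟨h.onPath_of_meshNeighbour hn hlβ hk hlα hk' hlγ hl rfl hm, orbitRep n j, j, rfl, ?_⟩
      convert hc using 1
      push_cast; ring
    -- The half of the path from `α` to `γ` already determines that `γ` is a mesh neighbour. Its
    -- letter is then not `n+1`, so its coordinate can be recovered from its time.
    · rintro ⟨⟨hp, -⟩, j, hf⟩
      obtain ⟨l, j₀, rfl, hlγ, hl⟩ := h.exists_at_of_foldedCoord hf
      have hm := h.meshNeighbour_of_path hp hlα hk' hlγ hl (by rw [hd2, hd]; ring)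
      have hj₀ : j₀ ≠ n + 1 := by
        rintro rfl
        rw [MeshNeighbour] at hm
        split_ifs at hm <;> omega
      refine ⟨j₀, hm, ?_⟩
      convert h.coord_of_at hlγ hl hj₀ using 2
      push_cast; ring
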